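/- Fix a refining sequence $(\mathbb T_n)_{n\in\mathbb N}$ of partitions of $[0,\infty)$: each $\mathbb T_n=\{0=t_0<t_1<\cdots\}$ satisfies $t_k\to\infty$, $\mathbb T_1\subset\mathbb T_2\subset\cdots$, and the mesh of $\mathbb T_n$ tends to $0$ on every compact interval. For $s\in\mathbb T_n$ let $s'=\min\{u\in\mathbb T_n : u>s\}$. Let $S:[0,\infty)\to\mathbb R^d$ be continuous with $S_i(t)>0$ for all $i$ and $t$, such that for all $i,j$ and all $t\ge 0$ the finite limit $$[S_i,S_j](t)=\lim_{n\to\infty}\sum_{s\in\mathbb T_n,\,s\le t}(S_i(s')-S_i(s))(S_j(s')-S_j(s))$$ exists and is continuous in $t$. Let $r:[0,\infty)\to\mathbb R$ be measurable with $\int_0^T|r(s)|\,ds<\infty$ for all $T>0$, and let $B(t)=\exp\big(\int_0^t r(s)\,ds\big)$. For open $U\subset\mathbb R^d$, $V\subset\mathbb R^n$, let $C^{2,1}(U,V)$ be the class of functions $f:U\times V\to\mathbb R$ that are continuously differentiable in $(x,a)\in U\times V$ and twice continuously differentiable in $x\in U$, with all second partial derivatives $f_{x_k,x_m}$ continuous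 on $U\times V$. For a path $X:[0,\infty)\to\mathbb R^d$, a function $\xi:[0,\infty)\to\mathbb R^d$ is an *admissible integrand for $X$* if for each $T>0$ there are $n\in\mathbb N$, open sets $U\subset\mathbb R^d$, $V\subset\mathbb R^n$, a function $f\in C^{2,1}(U,V)$ and a continuous function $A:[0,T]\to V$ with components of bounded variation, such that $X(t)\in U$ and $\xi(t)=\nabla_x f(X(t),A(t))$ for $0\le t\le T$. The *Föllmer integral* is $$\int_0^t\xi(s)\,dX(s)=\lim_{n\to\infty}\sum_{s\in\mathbb T_n,\,s\le t}\xi(s)\cdot(X(s')-X(s)),$$ whenever this limit exists. A *trading strategy* is a pair $(\xi,\eta)$ in which $\xi$ is an admissible integrand for $S$ and $\eta:[0,\infty)\to\mathbb R$ is measurable with $\int_0^T|\eta(s)|\,d|B|(s)<\infty$ for all $T>0$, where $d|B|$ denotes Stieltjes integration with respect to the total variation of $B$. Its wealth is $V(t)=\xi(t)\cdot S(t)+\eta(t)B(t)$. It is *self-financing* if for all $t\ge 0$ $$V(t)=V(0)+\int_0^t\xi(s)\,dS(s)+\int_0^t\eta(s)\,dB(s),$$ where the first integral is a Föllmer integral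 and the second a Riemann–Stieltjes integral, and both exist. **Lemma.** Suppose that $\pi:[0,\infty)\to\mathbb R^d$ is an admissible integrand for $\log S=(\log S_1,\dots,\log S_d)$. Then: 1. The function $$V^\pi(t)=\exp\Big(\int_0^t\frac{\pi(s)}{S(s)}\,dS(s)-\frac12\sum_{i,j=1}^d\int_0^t\frac{\pi_i(s)\pi_j(s)}{S_i(s)S_j(s)}\,d[S_i,S_j](s)+\int_0^t\Big(1-\sum_{i=1}^d\pi_i(s)\Big)r(s)\,ds\Big)$$ is well defined for all $t\ge 0$: $\pi/S=(\pi_1/S_1,\dots,\pi_d/S_d)$ is an admissible integrand for $S$, and for every $t\ge0$ the first integral exists as a Föllmer integral, the integrals with respect to $[S_i,S_j]$ exist as Riemann–Stieltjes integrals, and the integrand of the last one is Lebesgue integrable on $[0,t]$. 2. The functions $$\xi_i(t)=\frac{\pi_i(t)V^\pi(t)}{S_i(t)},\quad i=1,\dots,d,\qquad \eta(t)=\frac{\big(1-\sum_{i=1}^d\pi_i(t)\big)V^\pi(t)}{B(t)}$$ form a self-financing trading strategy $(\xi,\eta)$, and its wealth is $V^\pi(t)$ for all $t\ge 0$. -/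

import Mathlib

open Set Filter Topology MeasureTheory

noncomputable section

namespace Follmer

/-! ### Partitions and covariation -/

/-- A refining sequence `(𝕋_n)` of partitions of `[0, ∞)`. The `n`-th partition is
`{pt n 0 < pt n 1 < ⋯}`, so that the successor of `s = pt n k` is `s' = pt n (k + 1)`. -/
structure PartitionSeq where
  pt : ℕ → ℕ → ℝ
  pt_zero : ∀ n, pt n 0 = 0
  strictMono : ∀ n, StrictMono (pt n)
  tendsto_atTop : ∀ n, Tendsto (pt n) atTop atTop
  refining : ∀ n, range (pt n) ⊆ range (pt (n + 1))
  mesh : ∀ T : ℝ, 0 < T → ∀ ε : ℝ, 0 < ε →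
    ∀ᶠ n in atTop, ∀ k, pt n k ≤ T → pt n (k + 1) - pt n k < ε

theorem PartitionSeq.finite_le (P : PartitionSeq) (n : ℕ) (t : ℝ) :
    {k : ℕ | P.pt n k ≤ t}.Finite := by
  have h : ∀ᶠ k in atTop, t < P.pt n k := (P.tendsto_atTop n).eventually_gt_atTop t
  obtain ⟨N, hN⟩ := eventually_atTop.1 h
  refine (finite_lt_nat N).subset fun k hk => ?_
  by_contra hkN
  exact absurd (hN k (not_lt.1 hkN)) (not_lt.2 hk)

/-- The (finitely many) indices `k` of the points of the `n`-th partition lying in `[0, t]`. -/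
def PartitionSeq.upTo (P : PartitionSeq) (n : ℕ) (t : ℝ) : Finset ℕ :=
  (P.finite_le n t).toFinset

theorem PartitionSeq.mem_upTo (P : PartitionSeq) (n : ℕ) (t : ℝ) (k : ℕ) :
    k ∈ P.upTo n t ↔ P.pt n k ≤ t := by
  simp [PartitionSeq.upTo]

/-- `∑_{s ∈ 𝕋_n, s ≤ t} (x(s') - x(s)) (y(s') - y(s))`. -/
def covSum (P : PartitionSeq) (x y : ℝ → ℝ) (t : ℝ) (n : ℕ) : ℝ :=
  ∑ k ∈ P.upTo n t,
    (x (P.pt n (k + 1)) - x (P.pt n k)) * (y (P.pt n (k + 1)) - y (P.pt n k))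

/-- The pathwise covariation `[x, y](t)`, as the limit of `covSum` (meaningful when the limit
exists, which is part of `IsQV`). -/
def covariation (P : PartitionSeq) (x y : ℝ → ℝ) (t : ℝ) : ℝ :=
  limUnder atTop (covSum P x y t)

/-- The class `QV^d` of continuous paths on `[0, ∞)` all of whose components admit
continuous pathwise covariations along `(𝕋_n)`. -/
structure IsQV {d : ℕ} (P : PartitionSeq) (S : ℝ → Fin d → ℝ) : Prop where
  continuousOn : ContinuousOn S (Ici 0)
  exists_cov : ∀ i j, ∀ t, 0 ≤ t →
    ∃ c : ℝ, Tendsto (covSum P (fun s => S s i) (fun s => S s j) t) atTop (𝓝 c)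
  continuousOn_cov : ∀ i j,
    ContinuousOn (covariation P (fun s => S s i) (fun s => S s j)) (Ici 0)

/-! ### Admissible integrands and the Föllmer integral -/

/-- The partial derivative `f_{x_k}(x, a)` with respect to the `k`-th component of the first
variable. -/
def partialX {d n : ℕ} (f : (Fin d → ℝ) × (Fin n → ℝ) → ℝ) (k : Fin d)
    (p : (Fin d → ℝ) × (Fin n → ℝ)) : ℝ :=
  fderiv ℝ (fun x => f (x, p.2)) p.1 (Pi.single k 1)

/-- The class `C^{2,1}(U, V)`: continuously differentiable in `(x, a) ∈ U × V` and twice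
continuously differentiable in `x`, the second partial derivatives `f_{x_k, x_m}` being
continuous on `U × V`. It is used for open `U` and `V` only. -/
structure IsC21 {d n : ℕ} (U : Set (Fin d → ℝ)) (V : Set (Fin n → ℝ))
    (f : (Fin d → ℝ) × (Fin n → ℝ) → ℝ) : Prop where
  contDiffOn : ContDiffOn ℝ 1 f (U ×ˢ V)
  differentiableOn_partialX : ∀ k, ∀ a ∈ V,
    DifferentiableOn ℝ (fun x => partialX f k (x, a)) U
  continuousOn_partialX₂ : ∀ k m, ContinuousOn (partialX (partialX f k) m) (U ×ˢ V)

/-- The class `CBV([0, T], V)` of continuous functions `[0, T] → V` whose components are of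
bounded variation. -/
structure IsCBV {n : ℕ} (T : ℝ) (V : Set (Fin n → ℝ)) (A : ℝ → Fin n → ℝ) : Prop where
  mapsTo : MapsTo A (Icc 0 T) V
  continuousOn : ContinuousOn A (Icc 0 T)
  boundedVariationOn : ∀ j, BoundedVariationOn (fun t => A t j) (Icc 0 T)

/-- `ξ` is an admissible integrand for the path `X`. -/
def IsAdmissible {d : ℕ} (X ξ : ℝ → Fin d → ℝ) : Prop :=
  ∀ T : ℝ, 0 < T → ∃ (n : ℕ) (U : Set (Fin d → ℝ)) (V : Set (Fin n → ℝ))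
    (f : (Fin d → ℝ) × (Fin n → ℝ) → ℝ) (A : ℝ → Fin n → ℝ),
    IsOpen U ∧ IsOpen V ∧ IsC21 U V f ∧ IsCBV T V A ∧
      ∀ t ∈ Icc 0 T, X t ∈ U ∧ ∀ k, ξ t k = partialX f k (X t, A t)

/-- `∑_{s ∈ 𝕋_n, s ≤ t} ξ(s) · (X(s') - X(s))`. -/
def follmerSum {d : ℕ} (P : PartitionSeq) (ξ X : ℝ → Fin d → ℝ) (t : ℝ) (n : ℕ) : ℝ :=
  ∑ k ∈ P.upTo n t, ξ (P.pt n k) ⬝ᵥ (X (P.pt n (k + 1)) - X (P.pt n k))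

/-- The Föllmer integral `∫_0^t ξ dX` exists as a limit of Riemann sums. -/
def FollmerIntegrable {d : ℕ} (P : PartitionSeq) (ξ X : ℝ → Fin d → ℝ) (t : ℝ) : Prop :=
  ∃ I : ℝ, Tendsto (follmerSum P ξ X t) atTop (𝓝 I)

/-- The Föllmer integral `∫_0^t ξ dX` (meaningful under `FollmerIntegrable`). -/
def follmerIntegral {d : ℕ} (P : PartitionSeq) (ξ X : ℝ → Fin d → ℝ) (t : ℝ) : ℝ :=
  limUnder atTop (follmerSum P ξ X t)

/-! ### Stieltjes integration -/

/-- `I` is the Riemann–Stieltjes integral `∫_a^b f dg`, for `a ≤ b`: the sums over tagged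
partitions of `[a, b]` tend to `I` as the mesh tends to zero. -/
def HasRSIntegral (f g : ℝ → ℝ) (a b I : ℝ) : Prop :=
  ∀ ε : ℝ, 0 < ε → ∃ δ : ℝ, 0 < δ ∧ ∀ (m : ℕ) (u τ : ℕ → ℝ), u 0 = a → u m = b →
    (∀ k < m, u (k + 1) - u k < δ ∧ u k ≤ τ k ∧ τ k ≤ u (k + 1)) →
    |∑ k ∈ Finset.range m, f (τ k) * (g (u (k + 1)) - g (u k)) - I| < ε

/-- The Riemann–Stieltjes integral `∫_a^b f dg` exists. -/
def RSIntegrable (f g : ℝ → ℝ) (a b : ℝ) : Prop :=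
  ∃ I : ℝ, HasRSIntegral f g a b I

open Classical in
/-- The Riemann–Stieltjes integral `∫_a^b f dg` (meaningful under `RSIntegrable`). -/
def rsIntegral (f g : ℝ → ℝ) (a b : ℝ) : ℝ :=
  if h : RSIntegrable f g a b then h.choose else 0

theorem variation_monotone {g : ℝ → ℝ} (hg : LocallyBoundedVariationOn g (Ici 0)) :
    Monotone fun t : ℝ => variationOnFromTo g (Ici 0) 0 (max t 0) := by
  intro s t hst
  exact variationOnFromTo.monotoneOn hg (by simp) (mem_Ici.2 (le_max_right s 0))
    (mem_Ici.2 (le_max_right t 0)) (max_le_max_right 0 hst)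

/-- The Lebesgue–Stieltjes measure `d|g|` on `[0, ∞)` of the total variation of a continuous
function `g` on `[0, ∞)` that is locally of bounded variation. -/
def variationMeasure (g : ℝ → ℝ) (hg : LocallyBoundedVariationOn g (Ici 0)) : Measure ℝ :=
  (variation_monotone hg).stieltjesFunction.measure

/-! ### The market model -/

/-- The bond price `B(t) = exp(∫_0^t r(s) ds)`. -/
def bond (r : ℝ → ℝ) (t : ℝ) : ℝ :=
  Real.exp (∫ s in (0 : ℝ)..t, r s)

/-- `(ξ, η)` is a trading strategy: `ξ` is an admissible integrand for `S`, and `η` is measurable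
on `[0, ∞)` with `∫_0^T |η| d|B| < ∞` for all `T > 0`. -/
structure IsTradingStrategy {d : ℕ} (S : ℝ → Fin d → ℝ) (B : ℝ → ℝ) (ξ : ℝ → Fin d → ℝ)
    (η : ℝ → ℝ) : Prop where
  admissible : IsAdmissible S ξ
  measurable : Measurable ((Ici (0 : ℝ)).domRestrict η)
  integrable : ∃ hB : LocallyBoundedVariationOn B (Ici 0),
    ∀ T : ℝ, 0 < T → ∫⁻ s in Icc 0 T, ‖η s‖ₑ ∂(variationMeasure B hB) < ⊤

/-- The wealth `V(t) = ξ(t) · S(t) + η(t) B(t)`. -/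
def wealth {d : ℕ} (S : ℝ → Fin d → ℝ) (B : ℝ → ℝ) (ξ : ℝ → Fin d → ℝ) (η : ℝ → ℝ)
    (t : ℝ) : ℝ :=
  ξ t ⬝ᵥ S t + η t * B t

/-- The trading strategy `(ξ, η)` is self-financing: its wealth satisfies
`V(t) = V(0) + ∫_0^t ξ dS + ∫_0^t η dB` for all `t ≥ 0`, with a Föllmer and a
Riemann–Stieltjes integral, both of which exist. -/
structure IsSelfFinancing {d : ℕ} (P : PartitionSeq) (S : ℝ → Fin d → ℝ) (B : ℝ → ℝ)
    (ξ : ℝ → Fin d → ℝ) (η : ℝ → ℝ) : Prop where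
  isTradingStrategy : IsTradingStrategy S B ξ η
  follmerIntegrable : ∀ t, 0 ≤ t → FollmerIntegrable P ξ S t
  rsIntegrable : ∀ t, 0 ≤ t → RSIntegrable η B 0 t
  wealth_eq : ∀ t, 0 ≤ t → wealth S B ξ η t =
    wealth S B ξ η 0 + follmerIntegral P ξ S t + rsIntegral η B 0 t

/-- The path `log S`, componentwise. -/
def logPath {d : ℕ} (S : ℝ → Fin d → ℝ) : ℝ → Fin d → ℝ :=
  fun t i => Real.log (S t i)

/-- The path `π / S`, componentwise. -/
def quotPath {d : ℕ} (π S : ℝ → Fin d → ℝ) : ℝ → Fin d → ℝ :=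
  fun t i => π t i / S t i

/-- The integrand `π_i π_j / (S_i S_j)`. -/
def covIntegrand {d : ℕ} (S π : ℝ → Fin d → ℝ) (i j : Fin d) (s : ℝ) : ℝ :=
  π s i * π s j / (S s i * S s j)

/-- The integrand `(1 - ∑ π_i) r`. -/
def bondIntegrand {d : ℕ} (r : ℝ → ℝ) (π : ℝ → Fin d → ℝ) (s : ℝ) : ℝ :=
  (1 - ∑ i, π s i) * r s

/-- The exponential expression
`V^π(t) = exp(∫_0^t π/S dS - 1/2 ∑_{i,j} ∫_0^t π_i π_j / (S_i S_j) d[S_i, S_j]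
  + ∫_0^t (1 - ∑ π_i) r ds)`. -/
def portfolioValue {d : ℕ} (P : PartitionSeq) (r : ℝ → ℝ) (S π : ℝ → Fin d → ℝ) (t : ℝ) : ℝ :=
  Real.exp (follmerIntegral P (quotPath π S) S t
    - 1 / 2 * ∑ i, ∑ j, rsIntegral (covIntegrand S π i j)
        (covariation P (fun s => S s i) (fun s => S s j)) 0 t
    + ∫ s in (0 : ℝ)..t, bondIntegrand r π s)

/-- The numbers of shares `ξ_i = π_i V^π / S_i`. -/
def stockHoldings {d : ℕ} (P : PartitionSeq) (r : ℝ → ℝ) (S π : ℝ → Fin d → ℝ) :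
    ℝ → Fin d → ℝ :=
  fun t i => π t i * portfolioValue P r S π t / S t i

/-- The number of bonds `η = (1 - ∑ π_i) V^π / B`. -/
def bondHoldings {d : ℕ} (P : PartitionSeq) (r : ℝ → ℝ) (S π : ℝ → Fin d → ℝ) : ℝ → ℝ :=
  fun t => (1 - ∑ i, π t i) * portfolioValue P r S π t / bond r t

end Follmer

end

/-!
Fix `T` and write `π / S = ∇_x g(S, A)` on `[0, T]`, where `g(x, a) = f(log x, a)`, `f` represents
`π` as an admissible integrand for `log S`, and `A` is continuous and of bounded variation.
Föllmer's Itô formula (`tendsto_follmerSum_partialX`) shows that `∫ π/S dS` exists and equals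
`g(S, A)` up to a continuous function of bounded variation. Hence `V^π = exp(g(S, A) + C)` with `C`
continuous and of bounded variation (`PortfolioRep.portfolioValue_eq`). So `V^π = h(S, (C, A))` for
the `C^{2,1}` function `h(x, (c, a)) = exp(g(x, a) + c)`, and `π_i V^π / S_i = h_{x_i}(S, (C, A))`
is an admissible integrand for `S`. As `h_{x_i x_j} = h (g_{x_i x_j} + g_{x_i} g_{x_j})`, in Itô's
formula for `h` all drift terms cancel except `(1 - ∑ π_i) V^π r dt = η dB`
(`PortfolioRep.itoDrift_expShift`), which is the self-financing condition.

All integrators of bounded variation occurring here (the components of `A`, the covariations and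
`∫ r`) are continuous, so on `[0, T]` they have densities with respect to one atomless finite
measure `ν` (`exists_common_density`, by Radon–Nikodym). All Riemann–Stieltjes integrals then become
Lebesgue integrals against `ν` (`HasDensity.hasRSIntegral`), the associativity of the integral is
the multiplication of densities, and the cancellation above is a pointwise identity.

Itô's formula itself is a second-order Taylor expansion along the partitions, uniform near the
compact curve `(S, A)`; the sums of the resulting terms converge by `tendsto_weighted_sum`, a weak
convergence statement for discrete signed measures of bounded mass.
-/

noncomputable section

namespace Follmer

/-! ### Riemann–Stieltjes integrals and densities -/

theorem HasRSIntegral.unique {f g : ℝ → ℝ} {a b I J : ℝ} (hab : a ≤ b)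
    (hI : HasRSIntegral f g a b I) (hJ : HasRSIntegral f g a b J) : I = J := by
  refine eq_of_abs_sub_lt_all fun ε hε => ?_
  obtain ⟨δ₁, hδ₁, h₁⟩ := hI (ε / 2) (half_pos hε)
  obtain ⟨δ₂, hδ₂, h₂⟩ := hJ (ε / 2) (half_pos hε)
  have hδ : 0 < min δ₁ δ₂ := lt_min hδ₁ hδ₂
  -- Compare both values with the Riemann sum over a fine equidistant partition.
  obtain ⟨m, hm⟩ := exists_nat_gt ((b - a) / min δ₁ δ₂)
  have hm0 : (0 : ℝ) < m := (div_nonneg (sub_nonneg.2 hab) hδ.le).trans_lt hm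
  have hstep : (b - a) / m < min δ₁ δ₂ := by
    rw [div_lt_iff₀ hδ] at hm
    rwa [div_lt_iff₀ hm0, mul_comm]
  have hnn : 0 ≤ (b - a) / m := div_nonneg (sub_nonneg.2 hab) hm0.le
  let u : ℕ → ℝ := fun k => a + k * ((b - a) / m)
  have hu : ∀ k, u (k + 1) - u k = (b - a) / m := fun k => by simp only [u]; push_cast; ring
  have hle : ∀ k, u k ≤ u (k + 1) := fun k => by linarith [hu k]
  have hu0 : u 0 = a := by simp [u]
  have hum : u m = b := by simp only [u]; field_simp; ring
  have H₁ := h₁ m u u hu0 hum fun k _ =>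
    ⟨(hu k).trans_lt (hstep.trans_le (min_le_left _ _)), le_rfl, hle k⟩
  have H₂ := h₂ m u u hu0 hum fun k _ =>
    ⟨(hu k).trans_lt (hstep.trans_le (min_le_right _ _)), le_rfl, hle k⟩
  rw [abs_lt] at H₁ H₂ ⊢
  constructor <;> linarith [H₁.1, H₁.2, H₂.1, H₂.2]

theorem HasRSIntegral.rsIntegral_eq {f g : ℝ → ℝ} {a b I : ℝ} (hab : a ≤ b)
    (hI : HasRSIntegral f g a b I) : rsIntegral f g a b = I := by
  have h : RSIntegrable f g a b := ⟨I, hI⟩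
  rw [rsIntegral, dif_pos h]
  exact h.choose_spec.unique hab hI

/-- A function whose increments are dominated by those of another one is of bounded variation on
compact intervals. -/
theorem boundedVariationOn_of_abs_sub_le {F G : ℝ → ℝ} {a b : ℝ}
    (h : ∀ s ∈ Icc a b, ∀ t ∈ Icc a b, s ≤ t → |F t - F s| ≤ G t - G s) :
    BoundedVariationOn F (Icc a b) := by
  rcases lt_or_ge b a with hab | hab
  · simp [Icc_eq_empty (not_le.2 hab)]
  have hG : MonotoneOn G (Icc a b) := fun s hs t ht hst =>
    sub_nonneg.1 ((abs_nonneg _).trans (h s hs t ht hst))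
  have hGv : BoundedVariationOn G (Icc a b) := by
    have := hG.locallyBoundedVariationOn a b (left_mem_Icc.2 hab) (right_mem_Icc.2 hab)
    rwa [inter_self] at this
  refine ne_top_of_le_ne_top hGv (iSup_le fun p => ?_)
  refine le_trans (Finset.sum_le_sum fun i _ => ?_) (eVariationOn.sum_le p.2.2.1 p.2.2.2)
  have hi := h _ (p.2.2.2 i) _ (p.2.2.2 (i + 1)) (p.2.2.1 (Nat.le_succ i))
  rw [edist_dist, edist_dist, Real.dist_eq, Real.dist_eq]
  exact ENNReal.ofReal_le_ofReal (hi.trans (le_abs_self _))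

/-- `F` is, on `[0, T]`, a primitive of `φ` with respect to the measure `ν`. -/
structure HasDensity (ν : Measure ℝ) (T : ℝ) (F φ : ℝ → ℝ) : Prop where
  integrable : IntervalIntegrable φ ν 0 T
  eq : ∀ t ∈ Icc 0 T, F t = F 0 + ∫ s in (0 : ℝ)..t, φ s ∂ν

namespace HasDensity

variable {ν : Measure ℝ} {T : ℝ} {F φ : ℝ → ℝ}

theorem mono_right (h : HasDensity ν T F φ) {t : ℝ} (ht : t ∈ Icc 0 T) : HasDensity ν t F φ where
  integrable := h.integrable.mono_set (uIcc_subset_uIcc left_mem_uIcc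
    (by rw [uIcc_of_le (ht.1.trans ht.2)]; exact ht))
  eq s hs := h.eq s ⟨hs.1, hs.2.trans ht.2⟩

theorem intervalIntegrable (h : HasDensity ν T F φ) {s t : ℝ} (hs : s ∈ Icc 0 T)
    (ht : t ∈ Icc 0 T) : IntervalIntegrable φ ν s t := by
  refine h.integrable.mono_set (uIcc_subset_uIcc ?_ ?_) <;>
    rwa [uIcc_of_le (hs.1.trans hs.2)]

theorem sub_eq (h : HasDensity ν T F φ) {s t : ℝ} (hs : s ∈ Icc 0 T) (ht : t ∈ Icc 0 T) :
    F t - F s = ∫ x in s..t, φ x ∂ν := by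
  have h0 : (0 : ℝ) ∈ Icc 0 T := ⟨le_rfl, hs.1.trans hs.2⟩
  rw [h.eq t ht, h.eq s hs, add_sub_add_left_eq_sub,
    intervalIntegral.integral_interval_sub_left (h.intervalIntegrable h0 ht)
      (h.intervalIntegrable h0 hs)]

theorem abs_sub_le (h : HasDensity ν T F φ) {s t : ℝ} (hs : s ∈ Icc 0 T) (ht : t ∈ Icc 0 T)
    (hst : s ≤ t) : |F t - F s| ≤ ∫ x in s..t, |φ x| ∂ν := by
  rw [h.sub_eq hs ht]
  exact intervalIntegral.abs_integral_le_integral_abs hst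

theorem continuousOn [NullSingletonClass ν] (h : HasDensity ν T F φ) : ContinuousOn F (Icc 0 T) := by
  rcases lt_or_ge T 0 with hT | hT
  · simp [Icc_eq_empty (not_le.2 hT)]
  have h1 := intervalIntegral.continuousOn_primitive_interval' h.integrable left_mem_uIcc
  rw [uIcc_of_le hT] at h1
  exact (continuousOn_const.add h1).congr h.eq

theorem boundedVariationOn (h : HasDensity ν T F φ) : BoundedVariationOn F (Icc 0 T) := by
  refine boundedVariationOn_of_abs_sub_le (G := fun t => ∫ s in (0 : ℝ)..t, |φ s| ∂ν)
    fun s hs t ht hst => ?_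
  have h0 : (0 : ℝ) ∈ Icc 0 T := ⟨le_rfl, hs.1.trans hs.2⟩
  rw [intervalIntegral.integral_interval_sub_left (h.intervalIntegrable h0 ht).abs
    (h.intervalIntegrable h0 hs).abs]
  exact h.abs_sub_le hs ht hst

/-- The Riemann–Stieltjes integral of a continuous function against a function with a density. -/
theorem hasRSIntegral (h : HasDensity ν T F φ) (hT : 0 ≤ T) {f : ℝ → ℝ}
    (hf : ContinuousOn f (Icc 0 T)) :
    HasRSIntegral f F 0 T (∫ s in (0 : ℝ)..T, f s * φ s ∂ν) := by
  intro ε hε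
  set M := ∫ s in (0 : ℝ)..T, |φ s| ∂ν with hM
  have hM0 : 0 ≤ M := intervalIntegral.integral_nonneg hT fun _ _ => abs_nonneg _
  obtain ⟨δ, hδ, hfδ⟩ := Metric.uniformContinuousOn_iff.1
    (isCompact_Icc.uniformContinuousOn_of_continuous hf) (ε / (M + 1)) (by positivity)
  refine ⟨δ, hδ, fun m u τ hu0 hum hk => ?_⟩
  have hstep : ∀ k < m, u k ≤ u (k + 1) := fun k hkm => (hk k hkm).2.1.trans (hk k hkm).2.2
  have hmono : ∀ k ≤ m, ∀ j ≤ k, u j ≤ u k := by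
    intro k
    induction k with
    | zero => intro _ j hj; rw [Nat.le_zero.1 hj]
    | succ k ih =>
      intro hkm j hj
      rcases Nat.of_le_succ hj with hj | rfl
      · exact (ih (by omega) j hj).trans (hstep k (by omega))
      · exact le_rfl
  have hmem : ∀ k ≤ m, u k ∈ Icc 0 T := fun k hkm =>
    ⟨hu0 ▸ hmono k hkm 0 (Nat.zero_le _), hum ▸ hmono m le_rfl k hkm⟩
  have hfφ : IntervalIntegrable (fun s => f s * φ s) ν 0 T :=
    h.integrable.continuousOn_mul (by rwa [uIcc_of_le hT])
  have hsub : ∀ {ψ : ℝ → ℝ}, IntervalIntegrable ψ ν 0 T → ∀ k < m,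
      IntervalIntegrable ψ ν (u k) (u (k + 1)) := by
    intro ψ hψ k hkm
    refine hψ.mono_set (uIcc_subset_uIcc ?_ ?_) <;> rw [uIcc_of_le hT]
    exacts [hmem k hkm.le, hmem (k + 1) hkm]
  have hsum : ∀ {ψ : ℝ → ℝ}, IntervalIntegrable ψ ν 0 T →
      ∑ k ∈ Finset.range m, ∫ s in u k..u (k + 1), ψ s ∂ν = ∫ s in (0 : ℝ)..T, ψ s ∂ν := by
    intro ψ hψ
    rw [intervalIntegral.sum_integral_adjacent_intervals (hsub hψ), hu0, hum]
  have hbound : ∀ k ∈ Finset.range m,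
      |f (τ k) * (F (u (k + 1)) - F (u k)) - ∫ s in u k..u (k + 1), f s * φ s ∂ν|
        ≤ ε / (M + 1) * ∫ s in u k..u (k + 1), |φ s| ∂ν := by
    intro k hkm
    rw [Finset.mem_range] at hkm
    rw [h.sub_eq (hmem k hkm.le) (hmem (k + 1) hkm), ← intervalIntegral.integral_const_mul,
      ← intervalIntegral.integral_sub ((hsub h.integrable k hkm).const_mul _) (hsub hfφ k hkm),
      ← intervalIntegral.integral_const_mul]
    refine (intervalIntegral.abs_integral_le_integral_abs (hstep k hkm)).trans ?_
    refine intervalIntegral.integral_mono_on (hstep k hkm)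
      (((hsub h.integrable k hkm).const_mul _).sub (hsub hfφ k hkm)).abs
      ((hsub h.integrable k hkm).abs.const_mul _) fun s hs => ?_
    obtain ⟨h1, h2, h3⟩ := hk k hkm
    rw [← sub_mul, abs_mul]
    refine mul_le_mul_of_nonneg_right (hfδ (τ k) ?_ s ?_ ?_).le (abs_nonneg _)
    · exact ⟨(hmem k hkm.le).1.trans h2, h3.trans (hmem (k + 1) hkm).2⟩
    · exact ⟨(hmem k hkm.le).1.trans hs.1, hs.2.trans (hmem (k + 1) hkm).2⟩
    · rw [Real.dist_eq, abs_lt]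
      constructor <;> linarith [hs.1, hs.2]
  rw [← hsum hfφ, ← Finset.sum_sub_distrib]
  calc _ ≤ ∑ k ∈ Finset.range m, ε / (M + 1) * ∫ s in u k..u (k + 1), |φ s| ∂ν :=
        (Finset.abs_sum_le_sum_abs _ _).trans (Finset.sum_le_sum hbound)
    _ = ε / (M + 1) * M := by rw [← Finset.mul_sum, hsum h.integrable.abs]
    _ < ε := by
      rw [div_mul_eq_mul_div, div_lt_iff₀ (by positivity)]
      nlinarith

end HasDensity

/-- The variation of a continuous function is continuous. -/
theorem continuousOn_variationOnFromTo {F : ℝ → ℝ} {s : Set ℝ} {a : ℝ} (ha : a ∈ s)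
    (hc : ContinuousOn F s) (hv : LocallyBoundedVariationOn F s) :
    ContinuousOn (variationOnFromTo F s a) s := by
  intro b hb
  have hl := variationOnFromTo.tendsto_left ha hb hv
    ((hc b hb).mono_left (nhdsWithin_mono _ inter_subset_left) : Tendsto F (𝓝[s ∩ Iio b] b) _)
  have hr := variationOnFromTo.tendsto_right ha hb hv
    ((hc b hb).mono_left (nhdsWithin_mono _ inter_subset_left) : Tendsto F (𝓝[s ∩ Ioi b] b) _)
  rw [dist_self, sub_zero] at hl
  rw [dist_self, add_zero] at hr
  rw [← continuousWithinAt_sdiff_self]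
  have hs : s \ {b} = s ∩ Iio b ∪ s ∩ Ioi b := by
    rw [← inter_union_distrib_left, Iio_union_Ioi]; rfl
  rw [hs]
  exact ContinuousWithinAt.union hl hr

/-- A continuous monotone function on `[0, T]` is the distribution function of an atomless finite
measure. -/
theorem exists_measure_of_monotoneOn {p : ℝ → ℝ} {T : ℝ} (hT : 0 ≤ T)
    (hp : MonotoneOn p (Icc 0 T)) (hc : ContinuousOn p (Icc 0 T)) :
    ∃ μ : Measure ℝ, IsFiniteMeasure μ ∧ NullSingletonClass μ ∧
      ∀ t ∈ Icc 0 T, μ.real (Ioc 0 t) = p t - p 0 := by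
  have hmem : ∀ x : ℝ, (projIcc 0 T hT x : ℝ) ∈ Icc 0 T := fun x => (projIcc 0 T hT x).2
  let G : StieltjesFunction ℝ :=
    { toFun := fun x => p (projIcc 0 T hT x)
      mono' := fun x y hxy => hp (hmem x) (hmem y) (monotone_projIcc hT hxy)
      right_continuous' := fun x =>
        ((hc.comp_continuous (continuous_subtype_val.comp continuous_projIcc)
          hmem).continuousAt).continuousWithinAt }
  have hG : Continuous G := hc.comp_continuous (continuous_subtype_val.comp continuous_projIcc) hmem
  refine ⟨G.measure, ?_, ⟨fun x => ?_⟩, fun t ht => ?_⟩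
  · refine G.isFiniteMeasure_of_forall_abs_le (C := max |p 0| |p T|) fun x => ?_
    exact abs_le_max_abs_abs (hp (left_mem_Icc.2 hT) (hmem x) (hmem x).1)
      (hp (hmem x) (right_mem_Icc.2 hT) (hmem x).2)
  · rw [StieltjesFunction.measure_singleton, hG.continuousAt.continuousWithinAt.leftLim_eq, sub_self,
      ENNReal.ofReal_zero]
  · have h0 : G 0 = p 0 := by simp [G]
    have h1 : G t = p t := by
      change p (projIcc 0 T hT t) = p t
      rw [projIcc_of_mem hT ht]
    rw [measureReal_def, StieltjesFunction.measure_Ioc, h0, h1, ENNReal.toReal_ofReal]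
    exact sub_nonneg.2 (hp (left_mem_Icc.2 hT) ht ht.1)

/-- Finitely many continuous functions of bounded variation have densities with respect to one
and the same atomless measure. -/
theorem exists_common_density {ι : Type*} [Fintype ι] {T : ℝ} (hT : 0 ≤ T) (F : ι → ℝ → ℝ)
    (hc : ∀ i, ContinuousOn (F i) (Icc 0 T)) (hv : ∀ i, BoundedVariationOn (F i) (Icc 0 T)) :
    ∃ ν : Measure ℝ, IsFiniteMeasure ν ∧ NullSingletonClass ν ∧
      ∃ φ : ι → ℝ → ℝ, ∀ i, HasDensity ν T (F i) (φ i) := by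
  have h0 : (0 : ℝ) ∈ Icc 0 T := left_mem_Icc.2 hT
  have hcv : ∀ i, ContinuousOn (variationOnFromTo (F i) (Icc 0 T) 0) (Icc 0 T) := fun i =>
    continuousOn_variationOnFromTo h0 (hc i) (hv i).locallyBoundedVariationOn
  -- `F i` is the difference of its variation function and of the variation function minus `F i`,
  -- both continuous and monotone; `ν` is the sum of all their measures.
  choose μ hμf hμa hμ using fun i => exists_measure_of_monotoneOn hT
    (variationOnFromTo.monotoneOn (hv i).locallyBoundedVariationOn h0) (hcv i)
  choose μ' hμf' hμa' hμ' using fun i => exists_measure_of_monotoneOn hT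
    (variationOnFromTo.sub_self_monotoneOn (hv i).locallyBoundedVariationOn h0) ((hcv i).sub (hc i))
  let ν : Measure ℝ := ∑ i, (μ i + μ' i)
  have hle : ∀ i, μ i + μ' i ≤ ν := fun i =>
    Finset.single_le_sum (f := fun i => μ i + μ' i) (fun _ _ => Measure.zero_le _) (Finset.mem_univ i)
  have hνf : IsFiniteMeasure ν := inferInstance
  have hν1 : ∀ i, μ i ≪ ν := fun i =>
    Measure.absolutelyContinuous_of_le ((Measure.le_add_right le_rfl).trans (hle i))
  have hν2 : ∀ i, μ' i ≪ ν := fun i =>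
    Measure.absolutelyContinuous_of_le ((Measure.le_add_left le_rfl).trans (hle i))
  refine ⟨ν, hνf, ⟨fun x => ?_⟩, fun i x => ((μ i).rnDeriv ν x).toReal - ((μ' i).rnDeriv ν x).toReal,
    fun i => ⟨?_, fun t ht => ?_⟩⟩
  · simp only [ν, Measure.finsetSum_apply, Measure.add_apply, measure_singleton, add_zero,
      Finset.sum_const_zero]
  · exact (Measure.integrable_toReal_rnDeriv.sub Measure.integrable_toReal_rnDeriv).intervalIntegrable
  · rw [intervalIntegral.integral_of_le ht.1,
      integral_sub Measure.integrable_toReal_rnDeriv.integrableOn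
        Measure.integrable_toReal_rnDeriv.integrableOn,
      Measure.setIntegral_toReal_rnDeriv (hν1 i), Measure.setIntegral_toReal_rnDeriv (hν2 i),
      hμ i t ht, hμ' i t ht]
    simp only [Pi.sub_apply]
    ring

/-! ### Sums along the partitions -/

namespace PartitionSeq

variable (P : PartitionSeq)

theorem pt_nonneg (n k : ℕ) : 0 ≤ P.pt n k :=
  (P.pt_zero n).symm.le.trans ((P.strictMono n).monotone (Nat.zero_le k))

/-- The first point of the `n`-th partition beyond `t`. -/
def nextPt (n : ℕ) (t : ℝ) : ℝ := P.pt n (P.upTo n t).card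

theorem upTo_eq_range (n : ℕ) (t : ℝ) : P.upTo n t = Finset.range (P.upTo n t).card := by
  obtain ⟨N, hN⟩ : ∃ N, P.upTo n t = Finset.range N := by
    have h : ∃ k, t < P.pt n k :=
      ((P.tendsto_atTop n).eventually_gt_atTop t).exists
    classical
    refine ⟨Nat.find h, Finset.ext fun k => ?_⟩
    rw [P.mem_upTo, Finset.mem_range, Nat.lt_find_iff]
    exact ⟨fun hk m hm => not_lt.2 (((P.strictMono n).monotone hm).trans hk),
      fun hk => not_lt.1 (hk k le_rfl)⟩
  rw [hN, Finset.card_range]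

theorem lt_nextPt (n : ℕ) (t : ℝ) : t < P.nextPt n t := by
  have h : (P.upTo n t).card ∉ P.upTo n t := by
    intro h
    rw [P.upTo_eq_range, Finset.card_range] at h
    exact Finset.notMem_range_self h
  rwa [P.mem_upTo, not_le] at h

theorem pt_succ_le_nextPt {n k : ℕ} {t : ℝ} (hk : k ∈ P.upTo n t) :
    P.pt n (k + 1) ≤ P.nextPt n t := by
  rw [P.upTo_eq_range, Finset.mem_range] at hk
  exact (P.strictMono n).monotone hk

theorem tendsto_nextPt {t : ℝ} (ht : 0 ≤ t) : Tendsto (fun n => P.nextPt n t) atTop (𝓝 t) := by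
  refine Metric.tendsto_atTop'.2 fun ε hε => ?_
  obtain ⟨N, hN⟩ := eventually_atTop.1 (P.mesh (t + 1) (by linarith) ε hε)
  refine ⟨N, fun n hn => ?_⟩
  have h0 : 0 ∈ P.upTo n t := by rw [P.mem_upTo, P.pt_zero]; exact ht
  obtain ⟨m, hm⟩ := Nat.exists_eq_succ_of_ne_zero (Finset.card_pos.2 ⟨0, h0⟩).ne'
  have hmt : P.pt n m ≤ t := by
    rw [← P.mem_upTo, P.upTo_eq_range, hm]
    exact Finset.self_mem_range_succ m
  have h1 := hN n hn.le m (by linarith)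
  have h2 := P.lt_nextPt n t
  have h3 : P.nextPt n t = P.pt n (m + 1) := by rw [nextPt, hm]
  rw [Real.dist_eq, abs_lt]
  constructor <;> linarith

theorem eventually_nextPt_lt {t T : ℝ} (ht : 0 ≤ t) (htT : t < T) :
    ∀ᶠ n in atTop, P.nextPt n t < T :=
  (P.tendsto_nextPt ht).eventually_lt_const htT

/-- The last increment of a sum over the partition points up to `t` reaches beyond `t`. -/
theorem sum_sub_eq (F : ℝ → ℝ) (n : ℕ) (t : ℝ) :
    ∑ k ∈ P.upTo n t, (F (P.pt n (k + 1)) - F (P.pt n k)) = F (P.nextPt n t) - F 0 := by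
  rw [P.upTo_eq_range, Finset.sum_range_sub (fun k => F (P.pt n k)), P.pt_zero, nextPt]

theorem tendsto_comp_nextPt {F : ℝ → ℝ} {t T : ℝ} (ht : 0 ≤ t) (htT : t < T)
    (hF : ContinuousOn F (Icc 0 T)) : Tendsto (fun n => F (P.nextPt n t)) atTop (𝓝 (F t)) := by
  refine (hF t ⟨ht, htT.le⟩).tendsto.comp (tendsto_nhdsWithin_iff.2 ⟨P.tendsto_nextPt ht, ?_⟩)
  filter_upwards [P.eventually_nextPt_lt ht htT] with n hn
  exact ⟨ht.trans (P.lt_nextPt n t).le, hn.le⟩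

theorem tendsto_sum_sub {F : ℝ → ℝ} {t T : ℝ} (ht : 0 ≤ t) (htT : t < T)
    (hF : ContinuousOn F (Icc 0 T)) :
    Tendsto (fun n => ∑ k ∈ P.upTo n t, (F (P.pt n (k + 1)) - F (P.pt n k))) atTop
      (𝓝 (F t - F 0)) := by
  simp only [P.sum_sub_eq]
  exact (P.tendsto_comp_nextPt ht htT hF).sub_const _

theorem upTo_filter_le (n : ℕ) {u t : ℝ} (hut : u ≤ t) :
    (P.upTo n t).filter (fun k => P.pt n k ≤ u) = P.upTo n u := by
  ext k
  rw [Finset.mem_filter, P.mem_upTo, P.mem_upTo]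
  exact ⟨fun h => h.2, fun h => ⟨h.trans hut, h⟩⟩

end PartitionSeq

theorem intervalIntegrable_finsetSum {ι : Type*} {s : Finset ι} {f : ι → ℝ → ℝ} {ν : Measure ℝ}
    {a b : ℝ} (h : ∀ i ∈ s, IntervalIntegrable (f i) ν a b) :
    IntervalIntegrable (fun x => ∑ i ∈ s, f i x) ν a b :=
  ⟨integrable_finsetSum s fun i hi => (h i hi).1, integrable_finsetSum s fun i hi => (h i hi).2⟩

/-- A continuous function on `[0, t]` is a uniform limit of linear combinations of indicator
functions of intervals `[0, u]`. -/
theorem exists_step_approx {φ : ℝ → ℝ} {t : ℝ} (ht : 0 ≤ t) (hφ : ContinuousOn φ (Icc 0 t))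
    {ε : ℝ} (hε : 0 < ε) :
    ∃ (M : ℕ) (c u : ℕ → ℝ), (∀ m < M, u m ∈ Icc 0 t) ∧
      ∀ s ∈ Icc 0 t, |φ s - ∑ m ∈ Finset.range M, c m * (if s ≤ u m then 1 else 0)| ≤ ε := by
  rcases ht.eq_or_lt with rfl | ht
  · refine ⟨1, fun _ => φ 0, fun _ => 0, fun _ _ => left_mem_Icc.2 le_rfl, fun s hs => ?_⟩
    obtain rfl : s = 0 := le_antisymm hs.2 hs.1
    simpa using hε.le
  obtain ⟨δ, hδ, hφδ⟩ := Metric.uniformContinuousOn_iff.1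
    (isCompact_Icc.uniformContinuousOn_of_continuous hφ) ε hε
  obtain ⟨N, hN⟩ := exists_nat_gt (t / δ)
  have hN0 : (0 : ℝ) < N := (div_pos ht hδ).trans hN
  let v : ℕ → ℝ := fun m => t * m / N
  have hv : ∀ m ≤ N, v m ∈ Icc 0 t := fun m hm => by
    have : (m : ℝ) ≤ N := by exact_mod_cast hm
    refine ⟨by positivity, ?_⟩
    rw [div_le_iff₀ hN0]
    exact mul_le_mul_of_nonneg_left this ht.le
  have hvN : v N = t := by simp only [v]; field_simp
  -- Abel summation turns the step function with values `φ (v (m + 1))` on `(v m, v (m + 1)]` into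
  -- a combination of indicators of `[0, v m]`.
  refine ⟨N + 1, fun m => φ (v m) - if m = N then 0 else φ (v (m + 1)), v,
    fun m hm => hv m (by omega), fun s hs => ?_⟩
  let j := ⌈s * N / t⌉₊
  have hj : ∀ m : ℕ, s ≤ v m ↔ j ≤ m := fun m => by
    rw [Nat.ceil_le, div_le_iff₀ ht, le_div_iff₀ hN0, mul_comm t]
  have hjN : j ≤ N := (hj N).1 (hvN.symm ▸ hs.2)
  have hsum : ∑ m ∈ Finset.range (N + 1), (φ (v m) - if m = N then 0 else φ (v (m + 1))) *
      (if s ≤ v m then 1 else 0) = φ (v j) := by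
    rw [Finset.sum_range_succ, if_pos rfl, sub_zero, hvN, if_pos hs.2, mul_one]
    have h1 : ∀ m ∈ Finset.range N, (φ (v m) - if m = N then 0 else φ (v (m + 1))) *
        (if s ≤ v m then 1 else 0) = if j ≤ m then φ (v m) - φ (v (m + 1)) else 0 := by
      intro m hm
      rw [if_neg (Finset.mem_range.1 hm).ne]
      simp only [hj, mul_ite, mul_one, mul_zero]
    rw [Finset.sum_congr rfl h1, ← Finset.sum_filter]
    have h2 : (Finset.range N).filter (fun m => j ≤ m) = Finset.Ico j N := by
      ext m; simp [and_comm]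
    rw [h2, Finset.sum_Ico_eq_sub _ hjN, Finset.sum_range_sub' (fun m => φ (v m)),
      Finset.sum_range_sub' (fun m => φ (v m)), hvN]
    ring
  rw [hsum, ← Real.dist_eq]
  refine (hφδ s hs (v j) (hv j hjN) ?_).le
  have h1 : s ≤ v j := (hj j).2 le_rfl
  have h2 : v j < s + δ := by
    have h3 : (j : ℝ) < s * N / t + 1 := Nat.ceil_lt_add_one (by have := hs.1; positivity)
    rw [div_lt_iff₀ hδ] at hN
    rw [div_lt_iff₀ hN0]
    have h4 : t * j < t * (s * N / t + 1) := mul_lt_mul_of_pos_left h3 ht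
    have h5 : t * (s * N / t + 1) = s * N + t := by field_simp
    nlinarith
  rw [Real.dist_eq, abs_lt]
  constructor <;> linarith

/-- If the weights `w n k`, placed at the points of the `n`-th partition, have bounded total
variation and their distribution functions converge to that of `q dν`, then they converge weakly
to `q dν`. -/
theorem tendsto_weighted_sum (P : PartitionSeq) {ν : Measure ℝ} {t M : ℝ} {φ q : ℝ → ℝ}
    {w : ℕ → ℕ → ℝ} (ht : 0 ≤ t) (hφ : ContinuousOn φ (Icc 0 t))
    (hq : IntervalIntegrable q ν 0 t)
    (hM : ∀ᶠ n in atTop, ∑ k ∈ P.upTo n t, |w n k| ≤ M)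
    (hw : ∀ u ∈ Icc 0 t, Tendsto (fun n => ∑ k ∈ P.upTo n u, w n k) atTop
      (𝓝 (∫ s in (0 : ℝ)..u, q s ∂ν))) :
    Tendsto (fun n => ∑ k ∈ P.upTo n t, φ (P.pt n k) * w n k) atTop
      (𝓝 (∫ s in (0 : ℝ)..t, φ s * q s ∂ν)) := by
  set K := ∫ s in (0 : ℝ)..t, |q s| ∂ν with hK
  have hK0 : 0 ≤ K := intervalIntegral.integral_nonneg ht fun _ _ => abs_nonneg _
  have hM0 : 0 ≤ M := by
    obtain ⟨n, hn⟩ := hM.exists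
    exact (Finset.sum_nonneg fun _ _ => abs_nonneg _).trans hn
  refine Metric.tendsto_nhds.2 fun ε hε => ?_
  have hη : 0 < ε / (M + K + 2) := by positivity
  obtain ⟨m, c, u, hu, hψ⟩ := exists_step_approx ht hφ hη
  set η := ε / (M + K + 2) with hη'
  -- For indicators of `[0, u]` the claim is the hypothesis `hw`, hence it holds for `ψ`.
  set ψ : ℝ → ℝ := fun s => ∑ i ∈ Finset.range m, c i * (if s ≤ u i then 1 else 0) with hψ'
  have hψint : ∀ i < m, IntervalIntegrable (fun s => (if s ≤ u i then 1 else 0) * q s) ν 0 t ∧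
      ∫ s in (0 : ℝ)..t, (if s ≤ u i then 1 else 0) * q s ∂ν = ∫ s in (0 : ℝ)..u i, q s ∂ν := by
    intro i hi
    have h1 : (fun s => (if s ≤ u i then (1 : ℝ) else 0) * q s) = (Iic (u i)).indicator q := by
      ext s
      by_cases hs : s ≤ u i <;> simp [hs]
    rw [h1]
    constructor
    · rw [intervalIntegrable_iff_integrableOn_Ioc_of_le ht] at hq ⊢
      exact hq.indicator measurableSet_Iic
    · rw [intervalIntegral.integral_of_le ht, intervalIntegral.integral_of_le (hu i hi).1,
        setIntegral_indicator measurableSet_Iic, Ioc_inter_Iic, min_eq_right (hu i hi).2]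
  have hψq : (fun s => ψ s * q s) =
      fun s => ∑ i ∈ Finset.range m, c i * ((if s ≤ u i then 1 else 0) * q s) := by
    ext s
    rw [hψ', Finset.sum_mul]
    exact Finset.sum_congr rfl fun i _ => mul_assoc _ _ _
  have hψqi : IntervalIntegrable (fun s => ψ s * q s) ν 0 t := by
    rw [hψq]
    exact intervalIntegrable_finsetSum fun i hi =>
      (hψint i (Finset.mem_range.1 hi)).1.const_mul _
  have hlim : Tendsto (fun n => ∑ k ∈ P.upTo n t, ψ (P.pt n k) * w n k) atTop
      (𝓝 (∫ s in (0 : ℝ)..t, ψ s * q s ∂ν)) := by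
    have h1 : ∫ s in (0 : ℝ)..t, ψ s * q s ∂ν =
        ∑ i ∈ Finset.range m, c i * ∫ s in (0 : ℝ)..u i, q s ∂ν := by
      rw [hψq, intervalIntegral.integral_finsetSum fun i hi =>
        (hψint i (Finset.mem_range.1 hi)).1.const_mul _]
      refine Finset.sum_congr rfl fun i hi => ?_
      rw [intervalIntegral.integral_const_mul, (hψint i (Finset.mem_range.1 hi)).2]
    have h2 : ∀ n, ∑ k ∈ P.upTo n t, ψ (P.pt n k) * w n k =
        ∑ i ∈ Finset.range m, c i * ∑ k ∈ P.upTo n (u i), w n k := by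
      intro n
      simp only [hψ', Finset.sum_mul]
      rw [Finset.sum_comm]
      refine Finset.sum_congr rfl fun i hi => ?_
      rw [← P.upTo_filter_le n (hu i (Finset.mem_range.1 hi)).2, Finset.sum_filter,
        Finset.mul_sum]
      exact Finset.sum_congr rfl fun k _ => by split_ifs <;> simp
    rw [h1]
    simp only [h2]
    exact tendsto_finsetSum _ fun i hi => (hw _ (hu i (Finset.mem_range.1 hi))).const_mul _
  have hφqi : IntervalIntegrable (fun s => φ s * q s) ν 0 t :=
    hq.continuousOn_mul (by rwa [uIcc_of_le ht])
  have hint : |(∫ s in (0 : ℝ)..t, φ s * q s ∂ν) - ∫ s in (0 : ℝ)..t, ψ s * q s ∂ν| ≤ η * K := by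
    rw [← intervalIntegral.integral_sub hφqi hψqi, hK, ← intervalIntegral.integral_const_mul]
    refine (intervalIntegral.abs_integral_le_integral_abs ht).trans ?_
    refine intervalIntegral.integral_mono_on ht (hφqi.sub hψqi).abs (hq.abs.const_mul _)
      fun s hs => ?_
    rw [← sub_mul, abs_mul]
    exact mul_le_mul_of_nonneg_right (hψ s hs) (abs_nonneg _)
  filter_upwards [hM, Metric.tendsto_nhds.1 hlim η hη] with n hMn hn
  have hsum : |∑ k ∈ P.upTo n t, φ (P.pt n k) * w n k - ∑ k ∈ P.upTo n t, ψ (P.pt n k) * w n k|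
      ≤ η * M := by
    rw [← Finset.sum_sub_distrib]
    refine (Finset.abs_sum_le_sum_abs _ _).trans ?_
    refine le_trans ?_ (mul_le_mul_of_nonneg_left hMn hη.le)
    rw [Finset.mul_sum]
    refine Finset.sum_le_sum fun k hk => ?_
    rw [← sub_mul, abs_mul]
    exact mul_le_mul_of_nonneg_right
      (hψ _ ⟨P.pt_nonneg n k, (P.mem_upTo n t k).1 hk⟩) (abs_nonneg _)
  have hε' : η * (M + K + 2) = ε := by rw [hη']; field_simp
  rw [Real.dist_eq] at hn ⊢
  rw [abs_le] at hsum hint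
  rw [abs_lt] at hn ⊢
  constructor <;> nlinarith [hsum.1, hsum.2, hint.1, hint.2, hn.1, hn.2]

theorem HasDensity.sum_abs_sub_le {P : PartitionSeq} {ν : Measure ℝ} {T t : ℝ} {F φ : ℝ → ℝ}
    (h : HasDensity ν T F φ) (ht : 0 ≤ t) {n : ℕ} (hn : P.nextPt n t < T) :
    ∑ k ∈ P.upTo n t, |F (P.pt n (k + 1)) - F (P.pt n k)| ≤ ∫ s in (0 : ℝ)..T, |φ s| ∂ν := by
  have h0T : 0 ≤ P.nextPt n t := ht.trans (P.lt_nextPt n t).le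
  have hmem : ∀ k ≤ (P.upTo n t).card, P.pt n k ∈ Icc 0 T := fun k hk =>
    ⟨P.pt_nonneg n k, ((P.strictMono n).monotone hk).trans hn.le⟩
  calc ∑ k ∈ P.upTo n t, |F (P.pt n (k + 1)) - F (P.pt n k)|
      = ∑ k ∈ Finset.range (P.upTo n t).card, |F (P.pt n (k + 1)) - F (P.pt n k)| := by
        rw [← P.upTo_eq_range]
    _ ≤ ∑ k ∈ Finset.range (P.upTo n t).card, ∫ s in P.pt n k..P.pt n (k + 1), |φ s| ∂ν :=
        Finset.sum_le_sum fun k hk => h.abs_sub_le (hmem k (Finset.mem_range.1 hk).le)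
          (hmem (k + 1) (Finset.mem_range.1 hk)) ((P.strictMono n).monotone (Nat.le_succ k))
    _ = ∫ s in (0 : ℝ)..P.nextPt n t, |φ s| ∂ν := by
        rw [intervalIntegral.sum_integral_adjacent_intervals fun k hk =>
          (h.intervalIntegrable (hmem k hk.le) (hmem (k + 1) hk)).abs, P.pt_zero]
        rfl
    _ ≤ ∫ s in (0 : ℝ)..T, |φ s| ∂ν :=
        intervalIntegral.integral_mono_interval le_rfl h0T hn.le
          (Eventually.of_forall fun _ => abs_nonneg _) h.integrable.abs

/-- Riemann sums along the partitions, against a function with a density. -/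
theorem HasDensity.tendsto_sum {P : PartitionSeq} {ν : Measure ℝ} [NullSingletonClass ν]
    {T t : ℝ} {F φ g : ℝ → ℝ} (h : HasDensity ν T F φ) (ht : 0 ≤ t) (htT : t < T)
    (hg : ContinuousOn g (Icc 0 t)) :
    Tendsto (fun n => ∑ k ∈ P.upTo n t, g (P.pt n k) * (F (P.pt n (k + 1)) - F (P.pt n k))) atTop
      (𝓝 (∫ s in (0 : ℝ)..t, g s * φ s ∂ν)) := by
  have h0 : (0 : ℝ) ∈ Icc 0 T := ⟨le_rfl, ht.trans htT.le⟩
  refine tendsto_weighted_sum P (M := ∫ s in (0 : ℝ)..T, |φ s| ∂ν) ht hg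
    (h.mono_right ⟨ht, htT.le⟩).integrable ?_ fun u hu => ?_
  · filter_upwards [P.eventually_nextPt_lt ht htT] with n hn
    exact h.sum_abs_sub_le ht hn
  · rw [← h.sub_eq h0 ⟨hu.1, hu.2.trans htT.le⟩]
    exact P.tendsto_sum_sub hu.1 (hu.2.trans_lt htT) h.continuousOn

/-! ### Covariations -/

theorem abs_mul_le_half_sq (x y : ℝ) : |x * y| ≤ (x * x + y * y) / 2 := by
  rw [abs_le]
  constructor <;> nlinarith [sq_nonneg (x + y), sq_nonneg (x - y)]

namespace IsQV

variable {d : ℕ} {P : PartitionSeq} {S : ℝ → Fin d → ℝ}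

theorem tendsto_covSum (hS : IsQV P S) (i j : Fin d) {t : ℝ} (ht : 0 ≤ t) :
    Tendsto (covSum P (fun s => S s i) (fun s => S s j) t) atTop
      (𝓝 (covariation P (fun s => S s i) (fun s => S s j) t)) :=
  tendsto_nhds_limUnder (hS.exists_cov i j t ht)

theorem covariation_zero (hS : IsQV P S) (i j : Fin d) :
    covariation P (fun s => S s i) (fun s => S s j) 0 = 0 := by
  have h1 : ∀ n, P.upTo n 0 = {0} := fun n => by
    ext k
    rw [P.mem_upTo, Finset.mem_singleton, ← Nat.le_zero, ← (P.strictMono n).le_iff_le, P.pt_zero]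
  have hc : ∀ i, ContinuousOn (fun s => S s i) (Icc 0 1) := fun i =>
    ((continuousOn_pi.1 hS.continuousOn i).mono Icc_subset_Ici_self)
  have h2 := (P.tendsto_sum_sub le_rfl zero_lt_one (hc i)).mul
    (P.tendsto_sum_sub le_rfl zero_lt_one (hc j))
  refine tendsto_nhds_unique (hS.tendsto_covSum i j le_rfl) ?_
  simp only [sub_self, mul_zero] at h2
  refine h2.congr fun n => ?_
  simp only [covSum, h1, Finset.sum_singleton]

/-- The increments of `[S_i, S_j]` are dominated by those of `([S_i, S_i] + [S_j, S_j]) / 2`. -/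
theorem boundedVariationOn_covariation (hS : IsQV P S) (i j : Fin d) (T : ℝ) :
    BoundedVariationOn (covariation P (fun s => S s i) (fun s => S s j)) (Icc 0 T) := by
  refine boundedVariationOn_of_abs_sub_le (G := fun t =>
    (covariation P (fun s => S s i) (fun s => S s i) t +
      covariation P (fun s => S s j) (fun s => S s j) t) / 2) fun s hs t ht hst => ?_
  refine le_of_tendsto_of_tendsto' ((hS.tendsto_covSum i j ht.1).sub
    (hS.tendsto_covSum i j hs.1)).abs ((((hS.tendsto_covSum i i ht.1).add
    (hS.tendsto_covSum j j ht.1)).div_const 2).sub (((hS.tendsto_covSum i i hs.1).add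
    (hS.tendsto_covSum j j hs.1)).div_const 2)) fun n => ?_
  have hsub : P.upTo n s ⊆ P.upTo n t := fun k hk => by
    rw [P.mem_upTo] at hk ⊢; exact hk.trans hst
  simp only [covSum, ← Finset.sum_sdiff hsub]
  rw [add_sub_cancel_right]
  refine (Finset.abs_sum_le_sum_abs _ _).trans ?_
  refine (Finset.sum_le_sum fun k _ => abs_mul_le_half_sq _ _).trans (le_of_eq ?_)
  rw [← Finset.sum_div, Finset.sum_add_distrib]
  ring

/-- Weighted sums of products of increments converge to integrals against the covariation. -/
theorem tendsto_sum (hS : IsQV P S) {ν : Measure ℝ} {T t : ℝ} {i j : Fin d} {q g : ℝ → ℝ}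
    (hq : HasDensity ν T (covariation P (fun s => S s i) (fun s => S s j)) q) (ht : 0 ≤ t)
    (htT : t ≤ T) (hg : ContinuousOn g (Icc 0 t)) :
    Tendsto (fun n => ∑ k ∈ P.upTo n t, g (P.pt n k) *
      ((S (P.pt n (k + 1)) i - S (P.pt n k) i) * (S (P.pt n (k + 1)) j - S (P.pt n k) j))) atTop
      (𝓝 (∫ s in (0 : ℝ)..t, g s * q s ∂ν)) := by
  refine tendsto_weighted_sum P (M := (covariation P (fun s => S s i) (fun s => S s i) t +
    covariation P (fun s => S s j) (fun s => S s j) t) / 2 + 1) ht hg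
    (hq.mono_right ⟨ht, htT⟩).integrable ?_ fun u hu => ?_
  · have h := ((hS.tendsto_covSum i i ht).add (hS.tendsto_covSum j j ht)).div_const 2
    filter_upwards [h.eventually_le_const (lt_add_one _)] with n hn
    refine le_trans ?_ hn
    refine (Finset.sum_le_sum fun k _ => abs_mul_le_half_sq _ _).trans (le_of_eq ?_)
    rw [← Finset.sum_div, Finset.sum_add_distrib]
    rfl
  · have h := hq.eq u ⟨hu.1, hu.2.trans htT⟩
    rw [hS.covariation_zero, zero_add] at h
    rw [← h]
    exact hS.tendsto_covSum i j hu.1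

end IsQV

/-! ### Calculus in the class `C^{2,1}` -/

/-- The linear form `x ↦ ∑ v_i x_i` on `ℝ^d`. -/
def gradCLM {d : ℕ} (v : Fin d → ℝ) : (Fin d → ℝ) →L[ℝ] ℝ :=
  ∑ i, v i • ContinuousLinearMap.proj (R := ℝ) (φ := fun _ : Fin d => ℝ) i

theorem gradCLM_apply {d : ℕ} (v x : Fin d → ℝ) : gradCLM v x = ∑ i, v i * x i := by
  simp [gradCLM]

theorem gradCLM_single {d : ℕ} (v : Fin d → ℝ) (k : Fin d) : gradCLM v (Pi.single k 1) = v k := by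
  simp [gradCLM_apply, Pi.single_apply]

theorem clm_eq_gradCLM {d : ℕ} (L : (Fin d → ℝ) →L[ℝ] ℝ) :
    L = gradCLM fun k => L (Pi.single k 1) := by
  refine ContinuousLinearMap.coe_injective (LinearMap.pi_ext' fun k => LinearMap.ext_ring ?_)
  exact (gradCLM_single (fun k => L (Pi.single k 1)) k).symm

theorem _root_.HasFDerivAt.partialX_eq {d n : ℕ} {f : (Fin d → ℝ) × (Fin n → ℝ) → ℝ}
    {x : Fin d → ℝ} {a : Fin n → ℝ} {v : Fin d → ℝ}
    (h : HasFDerivAt (fun y => f (y, a)) (gradCLM v) x) (k : Fin d) :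
    partialX f k (x, a) = v k := by
  rw [partialX, h.fderiv, gradCLM_single]

namespace IsC21

variable {d n : ℕ} {U : Set (Fin d → ℝ)} {V : Set (Fin n → ℝ)}
  {f : (Fin d → ℝ) × (Fin n → ℝ) → ℝ}

theorem differentiableAt (hf : IsC21 U V f) (hU : IsOpen U) (hV : IsOpen V)
    {p : (Fin d → ℝ) × (Fin n → ℝ)} (hp : p ∈ U ×ˢ V) : DifferentiableAt ℝ f p :=
  (hf.contDiffOn.differentiableOn one_ne_zero).differentiableAt ((hU.prod hV).mem_nhds hp)

theorem continuousOn_fderiv (hf : IsC21 U V f) (hU : IsOpen U) (hV : IsOpen V) :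
    ContinuousOn (fderiv ℝ f) (U ×ˢ V) :=
  hf.contDiffOn.continuousOn_fderiv_of_isOpen (hU.prod hV) le_rfl

theorem hasFDerivAt_left (hf : IsC21 U V f) (hU : IsOpen U) (hV : IsOpen V)
    {x : Fin d → ℝ} {a : Fin n → ℝ} (hx : x ∈ U) (ha : a ∈ V) :
    HasFDerivAt (fun y => f (y, a)) (gradCLM fun k => partialX f k (x, a)) x := by
  have h : DifferentiableAt ℝ (fun y => f (y, a)) x :=
    (hf.differentiableAt hU hV (p := (x, a)) ⟨hx, ha⟩).comp x
      (differentiableAt_id.prodMk (differentiableAt_const a))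
  have := h.hasFDerivAt
  rwa [clm_eq_gradCLM (fderiv ℝ (fun y => f (y, a)) x)] at this

theorem hasFDerivAt_partialX (hf : IsC21 U V f) (hU : IsOpen U)
    {x : Fin d → ℝ} {a : Fin n → ℝ} (hx : x ∈ U) (ha : a ∈ V) (k : Fin d) :
    HasFDerivAt (fun y => partialX f k (y, a))
      (gradCLM fun m => partialX (partialX f k) m (x, a)) x := by
  have := ((hf.differentiableOn_partialX k a ha).differentiableAt (hU.mem_nhds hx)).hasFDerivAt
  rwa [clm_eq_gradCLM (fderiv ℝ (fun y => partialX f k (y, a)) x)] at this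

theorem partialX_eq_fderiv (hf : IsC21 U V f) (hU : IsOpen U) (hV : IsOpen V)
    {p : (Fin d → ℝ) × (Fin n → ℝ)} (hp : p ∈ U ×ˢ V) (k : Fin d) :
    partialX f k p = fderiv ℝ f p (Pi.single k 1, 0) := by
  have h : HasFDerivAt (fun y => f (y, p.2))
      ((fderiv ℝ f p).comp (ContinuousLinearMap.inl ℝ (Fin d → ℝ) (Fin n → ℝ))) p.1 :=
    (hf.differentiableAt hU hV hp).hasFDerivAt.comp (x := p.1) (hasFDerivAt_prodMk_left p.1 p.2)
  rw [partialX, h.fderiv]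
  simp

theorem continuousOn_partialX (hf : IsC21 U V f) (hU : IsOpen U) (hV : IsOpen V) (k : Fin d) :
    ContinuousOn (partialX f k) (U ×ˢ V) :=
  ((hf.continuousOn_fderiv hU hV).clm_apply continuousOn_const).congr fun _ hp =>
    hf.partialX_eq_fderiv hU hV hp k

/-- A criterion for the class `C^{2,1}` in terms of given first and second derivatives. -/
theorem of_hasFDerivAt (hU : IsOpen U) (hc : ContDiffOn ℝ 1 f (U ×ˢ V))
    {D : Fin d → (Fin d → ℝ) × (Fin n → ℝ) → ℝ}
    {D₂ : Fin d → Fin d → (Fin d → ℝ) × (Fin n → ℝ) → ℝ}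
    (hD : ∀ x ∈ U, ∀ a ∈ V, HasFDerivAt (fun y => f (y, a)) (gradCLM fun k => D k (x, a)) x)
    (hD₂ : ∀ k, ∀ x ∈ U, ∀ a ∈ V,
      HasFDerivAt (fun y => D k (y, a)) (gradCLM fun m => D₂ k m (x, a)) x)
    (hD₂c : ∀ k m, ContinuousOn (D₂ k m) (U ×ˢ V)) :
    IsC21 U V f ∧ ∀ p ∈ U ×ˢ V, ∀ k, partialX f k p = D k p ∧
      ∀ m, partialX (partialX f k) m p = D₂ k m p := by
  have h1 : ∀ x ∈ U, ∀ a ∈ V, ∀ k, partialX f k (x, a) = D k (x, a) := fun x hx a ha k =>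
    (hD x hx a ha).partialX_eq k
  have h2 : ∀ k, ∀ x ∈ U, ∀ a ∈ V,
      HasFDerivAt (fun y => partialX f k (y, a)) (gradCLM fun m => D₂ k m (x, a)) x := by
    intro k x hx a ha
    refine (hD₂ k x hx a ha).congr_of_eventuallyEq ?_
    filter_upwards [hU.mem_nhds hx] with y hy using h1 y hy a ha k
  have h3 : ∀ p ∈ U ×ˢ V, ∀ k m, partialX (partialX f k) m p = D₂ k m p := fun p hp k m =>
    (h2 k p.1 hp.1 p.2 hp.2).partialX_eq m
  exact ⟨⟨hc, fun k a ha x hx => (h2 k x hx a ha).differentiableAt.differentiableWithinAt,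
    fun k m => (hD₂c k m).congr fun p hp => h3 p hp k m⟩,
    fun p hp k => ⟨h1 p.1 hp.1 p.2 hp.2 k, h3 p hp k⟩⟩

end IsC21

/-- A continuous function on an open set is uniformly continuous around a compact subset. -/
theorem exists_delta_of_isCompact {E F : Type*} [PseudoMetricSpace E] [PseudoMetricSpace F]
    {W K : Set E} {G : E → F} (hW : IsOpen W) (hG : ContinuousOn G W) (hK : IsCompact K)
    (hKW : K ⊆ W) {ε : ℝ} (hε : 0 < ε) :
    ∃ δ > 0, ∀ p ∈ K, ∀ q, dist q p < δ → q ∈ W ∧ dist (G q) (G p) < ε := by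
  obtain ⟨δ₁, hδ₁, h₁⟩ := hK.exists_thickening_subset_open hW hKW
  have h := hK.uniformContinuousAt_of_continuousAt G
    (fun a ha => hG.continuousAt (hW.mem_nhds (hKW ha))) (Metric.dist_mem_uniformity hε)
  obtain ⟨δ₂, hδ₂, h₂⟩ := Metric.mem_uniformity_dist.1 h
  refine ⟨min δ₁ δ₂, lt_min hδ₁ hδ₂, fun p hp q hq => ⟨h₁ ?_, ?_⟩⟩
  · exact Metric.mem_thickening_iff.2 ⟨p, hp, hq.trans_le (min_le_left _ _)⟩
  · rw [dist_comm]
    exact h₂ (a := p) (b := q) (by rw [dist_comm]; exact hq.trans_le (min_le_right _ _)) hp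

/-- Second-order Taylor estimate on `[0, 1]`. -/
theorem abs_taylor_two_le {φ φ₁ φ₂ : ℝ → ℝ} {C : ℝ}
    (h₁ : ∀ θ ∈ Icc (0 : ℝ) 1, HasDerivAt φ (φ₁ θ) θ)
    (h₂ : ∀ θ ∈ Icc (0 : ℝ) 1, HasDerivAt φ₁ (φ₂ θ) θ)
    (hC : ∀ θ ∈ Icc (0 : ℝ) 1, |φ₂ θ - φ₂ 0| ≤ C) :
    |φ 1 - φ 0 - φ₁ 0 - 1 / 2 * φ₂ 0| ≤ C := by
  have hC0 : 0 ≤ C := (abs_nonneg _).trans (hC 0 (left_mem_Icc.2 zero_le_one))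
  have key : ∀ θ ∈ Icc (0 : ℝ) 1, |φ₁ θ - φ₁ 0 - θ * φ₂ 0| ≤ C := by
    intro θ hθ
    have h := norm_image_sub_le_of_norm_deriv_le_segment' (a := 0) (b := 1) (C := C)
      (f := fun θ => φ₁ θ - θ * φ₂ 0) (f' := fun θ => φ₂ θ - 1 * φ₂ 0)
      (fun x hx => ((h₂ x hx).sub ((hasDerivAt_id x).mul_const (φ₂ 0))).hasDerivWithinAt)
      (fun x hx => by
        rw [Real.norm_eq_abs, one_mul]; exact hC x (Ico_subset_Icc_self hx)) θ hθ
    rw [Real.norm_eq_abs] at h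
    have h' : φ₁ θ - θ * φ₂ 0 - (φ₁ 0 - 0 * φ₂ 0) = φ₁ θ - φ₁ 0 - θ * φ₂ 0 := by ring
    rw [h'] at h
    refine h.trans ?_
    nlinarith [hθ.1, hθ.2]
  have h := norm_image_sub_le_of_norm_deriv_le_segment_01' (C := C)
    (f := fun θ => φ θ - θ * φ₁ 0 - θ ^ 2 * (1 / 2 * φ₂ 0))
    (f' := fun θ => φ₁ θ - 1 * φ₁ 0 - (2 * θ) * (1 / 2 * φ₂ 0))
    (fun x hx => (((h₁ x hx).sub ((hasDerivAt_id x).mul_const (φ₁ 0))).sub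
      ((by simpa using hasDerivAt_pow 2 x : HasDerivAt (fun θ : ℝ => θ ^ 2) (2 * x) x).mul_const
        (1 / 2 * φ₂ 0))).hasDerivWithinAt)
    (fun x hx => by
      rw [Real.norm_eq_abs]
      have h' : φ₁ x - 1 * φ₁ 0 - (2 * x) * (1 / 2 * φ₂ 0) = φ₁ x - φ₁ 0 - x * φ₂ 0 := by ring
      rw [h']
      exact key x (Ico_subset_Icc_self hx))
  rw [Real.norm_eq_abs] at h
  convert h using 2
  ring

theorem sum_sum_abs_mul_le {d : ℕ} (v : Fin d → ℝ) :
    ∑ k, ∑ m, |v k * v m| ≤ d * ∑ k, v k * v k := by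
  refine (Finset.sum_le_sum fun k _ => Finset.sum_le_sum fun m _ =>
    abs_mul_le_half_sq (v k) (v m)).trans (le_of_eq ?_)
  simp only [add_div, Finset.sum_add_distrib, Finset.sum_const, Finset.card_univ, Fintype.card_fin,
    nsmul_eq_mul, ← Finset.mul_sum, ← Finset.sum_div]
  ring

namespace IsC21

variable {d n : ℕ} {U : Set (Fin d → ℝ)} {V : Set (Fin n → ℝ)}
  {f : (Fin d → ℝ) × (Fin n → ℝ) → ℝ}

/-- Second-order expansion in the first variable, uniformly around a compact set. -/
theorem exists_delta_taylor_left (hf : IsC21 U V f) (hU : IsOpen U) (hV : IsOpen V)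
    {K : Set ((Fin d → ℝ) × (Fin n → ℝ))} (hK : IsCompact K) (hKW : K ⊆ U ×ˢ V) {ε : ℝ}
    (hε : 0 < ε) :
    ∃ δ > 0, ∀ x a, (x, a) ∈ K → ∀ y, dist y x < δ →
      |f (y, a) - f (x, a) - ∑ k, partialX f k (x, a) * (y k - x k) -
        1 / 2 * ∑ k, ∑ m, partialX (partialX f k) m (x, a) * ((y k - x k) * (y m - x m))|
      ≤ ε * ∑ k, (y k - x k) * (y k - x k) := by
  have hη : 0 < ε / (d + 1) := by positivity
  obtain ⟨δ, hδ, h⟩ := exists_delta_of_isCompact (hU.prod hV)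
    (G := fun p (k : Fin d) (m : Fin d) => partialX (partialX f k) m p)
    (continuousOn_pi.2 fun k => continuousOn_pi.2 fun m => hf.continuousOn_partialX₂ k m) hK hKW hη
  refine ⟨δ, hδ, fun x a hxa y hy => ?_⟩
  have hline : ∀ θ : ℝ, HasDerivAt (fun θ : ℝ => x + θ • (y - x)) (y - x) θ := fun θ => by
    simpa using ((hasDerivAt_id θ).smul_const (y - x)).const_add x
  have hball : ∀ θ ∈ Icc (0 : ℝ) 1, dist (x + θ • (y - x), a) (x, a) < δ := by
    intro θ hθ
    rw [Prod.dist_eq, dist_self, max_eq_left dist_nonneg, dist_eq_norm, add_sub_cancel_left,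
      norm_smul, Real.norm_of_nonneg hθ.1]
    rw [dist_eq_norm] at hy
    exact (mul_le_of_le_one_left (norm_nonneg _) hθ.2).trans_lt hy
  have hmem : ∀ θ ∈ Icc (0 : ℝ) 1, (x + θ • (y - x), a) ∈ U ×ˢ V := fun θ hθ =>
    (h _ hxa _ (hball θ hθ)).1
  have H := abs_taylor_two_le (φ := fun θ : ℝ => f (x + θ • (y - x), a))
    (φ₁ := fun θ => ∑ k, partialX f k (x + θ • (y - x), a) * (y k - x k))
    (φ₂ := fun θ => ∑ k, ∑ m, partialX (partialX f k) m (x + θ • (y - x), a) *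
      ((y k - x k) * (y m - x m))) (C := ε * ∑ k, (y k - x k) * (y k - x k)) ?_ ?_ ?_
  · simpa using H
  · intro θ hθ
    have h1 := (hf.hasFDerivAt_left hU hV (hmem θ hθ).1 (hmem θ hθ).2).comp_hasDerivAt θ (hline θ)
    rw [gradCLM_apply] at h1
    exact h1
  · intro θ hθ
    have h1 : ∀ k, HasDerivAt (fun θ : ℝ => partialX f k (x + θ • (y - x), a) * (y k - x k))
        (∑ m, partialX (partialX f k) m (x + θ • (y - x), a) *
          ((y k - x k) * (y m - x m))) θ := by
      intro k
      have h2 := ((hf.hasFDerivAt_partialX hU (hmem θ hθ).1 (hmem θ hθ).2 k).comp_hasDerivAt θ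
        (hline θ)).mul_const (y k - x k)
      rw [gradCLM_apply, Finset.sum_mul] at h2
      convert! h2 using 1
      refine Finset.sum_congr rfl fun m _ => ?_
      rw [Pi.sub_apply]
      ring
    exact HasDerivAt.fun_sum fun k _ => h1 k
  · intro θ hθ
    have h1 := (h _ hxa _ (hball θ hθ)).2
    have h2 : ∀ k m, |partialX (partialX f k) m (x + θ • (y - x), a) -
        partialX (partialX f k) m (x, a)| ≤ ε / (d + 1) := fun k m => by
      rw [← Real.dist_eq]
      exact (dist_le_pi_dist (fun m => partialX (partialX f k) m (x + θ • (y - x), a))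
        (fun m => partialX (partialX f k) m (x, a)) m).trans
        ((dist_le_pi_dist (fun k m => partialX (partialX f k) m (x + θ • (y - x), a))
        (fun k m => partialX (partialX f k) m (x, a)) k).trans h1.le)
    simp only [zero_smul, add_zero]
    rw [← Finset.sum_sub_distrib]
    simp only [← Finset.sum_sub_distrib, ← sub_mul]
    calc _ ≤ ∑ k, ∑ m, ε / (d + 1) * |(y k - x k) * (y m - x m)| := by
          refine (Finset.abs_sum_le_sum_abs _ _).trans (Finset.sum_le_sum fun k _ => ?_)
          refine (Finset.abs_sum_le_sum_abs _ _).trans (Finset.sum_le_sum fun m _ => ?_)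
          rw [abs_mul]
          exact mul_le_mul_of_nonneg_right (h2 k m) (abs_nonneg _)
      _ ≤ ε / (d + 1) * (d * ∑ k, (y k - x k) * (y k - x k)) := by
          simp only [← Finset.mul_sum]
          exact mul_le_mul_of_nonneg_left (sum_sum_abs_mul_le fun k => y k - x k) hη.le
      _ ≤ ε * ∑ k, (y k - x k) * (y k - x k) := by
          rw [← mul_assoc]
          refine mul_le_mul_of_nonneg_right ?_ (Finset.sum_nonneg fun k _ => mul_self_nonneg _)
          rw [div_mul_eq_mul_div, div_le_iff₀ (by positivity)]
          nlinarith

/-- First-order expansion in the second variable, uniformly around a compact set. -/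
theorem exists_delta_taylor_right (hf : IsC21 U V f) (hU : IsOpen U) (hV : IsOpen V)
    {K : Set ((Fin d → ℝ) × (Fin n → ℝ))} (hK : IsCompact K) (hKW : K ⊆ U ×ˢ V) {ε : ℝ}
    (hε : 0 < ε) :
    ∃ δ > 0, ∀ x a, (x, a) ∈ K → ∀ y b, dist y x < δ → dist b a < δ →
      |f (y, b) - f (y, a) - fderiv ℝ f (x, a) (0, b - a)| ≤ ε * ∑ j, |b j - a j| := by
  obtain ⟨δ, hδ, h⟩ := exists_delta_of_isCompact (hU.prod hV) (hf.continuousOn_fderiv hU hV)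
    hK hKW hε
  refine ⟨δ, hδ, fun x a hxa y b hy hb => ?_⟩
  have H := (convex_ball (x, a) δ).norm_image_sub_le_of_norm_fderiv_le' (𝕜 := ℝ)
    (φ := fderiv ℝ f (x, a)) (C := ε) (f := f) (x := (y, a)) (y := (y, b))
    (fun p hp => hf.differentiableAt hU hV (h _ hxa p hp).1)
    (fun p hp => by rw [← dist_eq_norm]; exact (h _ hxa p hp).2.le)
    (Metric.mem_ball.2 (max_lt hy (by rwa [dist_self]))) (Metric.mem_ball.2 (max_lt hy hb))
  rw [Real.norm_eq_abs, Prod.mk_sub_mk, sub_self] at H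
  refine H.trans (mul_le_mul_of_nonneg_left ?_ hε.le)
  rw [Prod.norm_mk, norm_zero, max_eq_right (norm_nonneg _)]
  refine (pi_norm_le_iff_of_nonneg (Finset.sum_nonneg fun _ _ => abs_nonneg _)).2 fun j => ?_
  exact Finset.single_le_sum (f := fun j => |b j - a j|) (fun _ _ => abs_nonneg _)
    (Finset.mem_univ j)

end IsC21

/-! ### Föllmer's Itô formula -/

theorem fderiv_zero_right {d n : ℕ} (f : (Fin d → ℝ) × (Fin n → ℝ) → ℝ)
    (p : (Fin d → ℝ) × (Fin n → ℝ)) (v : Fin n → ℝ) :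
    fderiv ℝ f p (0, v) = ∑ j, fderiv ℝ f p (0, Pi.single j 1) * v j := by
  have h := congrArg (fun L => L v) (clm_eq_gradCLM
    ((fderiv ℝ f p).comp (ContinuousLinearMap.inr ℝ (Fin d → ℝ) (Fin n → ℝ))))
  rw [gradCLM_apply] at h
  simpa using h

/-- Eventually, all increments of a continuous path along the partition up to `t` are small. -/
theorem PartitionSeq.eventually_dist_lt (P : PartitionSeq) {E : Type*} [PseudoMetricSpace E]
    {X : ℝ → E} {t T : ℝ} (ht : 0 ≤ t) (htT : t < T) (hX : ContinuousOn X (Icc 0 T)) {δ : ℝ}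
    (hδ : 0 < δ) :
    ∀ᶠ n in atTop, ∀ k ∈ P.upTo n t, dist (X (P.pt n (k + 1))) (X (P.pt n k)) < δ := by
  obtain ⟨δ', hδ', h⟩ := Metric.uniformContinuousOn_iff.1
    (isCompact_Icc.uniformContinuousOn_of_continuous hX) δ hδ
  filter_upwards [P.eventually_nextPt_lt ht htT, P.mesh T (ht.trans_lt htT) δ' hδ'] with n h1 h2 k hk
  have hk' := P.pt_succ_le_nextPt hk
  have hlt := P.strictMono n (Nat.lt_succ_self k)
  refine h _ ⟨P.pt_nonneg n _, hk'.trans h1.le⟩ _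
    ⟨P.pt_nonneg n _, hlt.le.trans (hk'.trans h1.le)⟩ ?_
  rw [Real.dist_eq, abs_of_pos (sub_pos.2 hlt)]
  exact h2 k (hlt.le.trans (hk'.trans h1.le))

theorem follmerSum_congr {d : ℕ} (P : PartitionSeq) {ξ ξ' X : ℝ → Fin d → ℝ} {t : ℝ}
    (h : ∀ s ∈ Icc 0 t, ξ s = ξ' s) : follmerSum P ξ X t = follmerSum P ξ' X t := by
  funext n
  refine Finset.sum_congr rfl fun k hk => ?_
  rw [h _ ⟨P.pt_nonneg n k, (P.mem_upTo n t k).1 hk⟩]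

section Ito

variable {d m : ℕ} {P : PartitionSeq} {ν : Measure ℝ} [NullSingletonClass ν] {T : ℝ}
  {X : ℝ → Fin d → ℝ} {q : Fin d → Fin d → ℝ → ℝ} {A α : ℝ → Fin m → ℝ}
  {U : Set (Fin d → ℝ)} {V : Set (Fin m → ℝ)} {f : (Fin d → ℝ) × (Fin m → ℝ) → ℝ}

/-- The remainder in the second-order expansion of `f(X, A)` along the partitions is
negligible. -/
theorem tendsto_ito_remainder (hX : IsQV P X)
    (hA : ∀ j, HasDensity ν T (fun t => A t j) (fun t => α t j))
    (hU : IsOpen U) (hV : IsOpen V) (hf : IsC21 U V f)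
    (hXU : ∀ t ∈ Icc 0 T, X t ∈ U) (hAV : ∀ t ∈ Icc 0 T, A t ∈ V)
    {t : ℝ} (ht : 0 ≤ t) (htT : t < T) :
    Tendsto (fun n => ∑ k ∈ P.upTo n t,
      (f (X (P.pt n (k + 1)), A (P.pt n (k + 1))) - f (X (P.pt n k), A (P.pt n k))
        - fderiv ℝ f (X (P.pt n k), A (P.pt n k)) (0, A (P.pt n (k + 1)) - A (P.pt n k))
        - ∑ i, partialX f i (X (P.pt n k), A (P.pt n k)) *
            (X (P.pt n (k + 1)) i - X (P.pt n k) i)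
        - 1 / 2 * ∑ i, ∑ j, partialX (partialX f i) j (X (P.pt n k), A (P.pt n k)) *
            ((X (P.pt n (k + 1)) i - X (P.pt n k) i) *
              (X (P.pt n (k + 1)) j - X (P.pt n k) j)))) atTop (𝓝 0) := by
  have hXc : ContinuousOn X (Icc 0 T) := hX.continuousOn.mono Icc_subset_Ici_self
  have hAc : ContinuousOn A (Icc 0 T) := continuousOn_pi.2 fun j => (hA j).continuousOn
  set K := (fun s => (X s, A s)) '' Icc 0 T with hKdef
  have hK : IsCompact K := isCompact_Icc.image_of_continuousOn (hXc.prodMk hAc)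
  have hKW : K ⊆ U ×ˢ V := by
    rintro _ ⟨s, hs, rfl⟩
    exact ⟨hXU s hs, hAV s hs⟩
  -- Bounds for the total variation of `A` and for the sums of the squared increments of `X`.
  set MA := ∑ j, ∫ s in (0 : ℝ)..T, |α s j| ∂ν with hMA
  set MX := ∑ i, (covariation P (fun s => X s i) (fun s => X s i) t + 1) with hMX
  have hqv : ∀ᶠ n in atTop, ∀ i, covSum P (fun s => X s i) (fun s => X s i) t n ≤
      covariation P (fun s => X s i) (fun s => X s i) t + 1 :=
    eventually_all.2 fun i => (hX.tendsto_covSum i i ht).eventually_le_const (lt_add_one _)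
  have hMA0 : 0 ≤ MA := Finset.sum_nonneg fun j _ =>
    intervalIntegral.integral_nonneg (ht.trans htT.le) fun _ _ => abs_nonneg _
  have hMX0 : 0 ≤ MX := by
    obtain ⟨n, hn⟩ := hqv.exists
    exact Finset.sum_nonneg fun i _ =>
      (Finset.sum_nonneg fun k _ => mul_self_nonneg _).trans (hn i)
  refine Metric.tendsto_nhds.2 fun ε hε => ?_
  have hη : 0 < ε / (MA + MX + 1) := by positivity
  set η := ε / (MA + MX + 1) with hηdef
  obtain ⟨δ₁, hδ₁, h₁⟩ := hf.exists_delta_taylor_left hU hV hK hKW hη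
  obtain ⟨δ₂, hδ₂, h₂⟩ := hf.exists_delta_taylor_right hU hV hK hKW hη
  filter_upwards [hqv, P.eventually_nextPt_lt ht htT,
    P.eventually_dist_lt ht htT hXc (lt_min hδ₁ hδ₂), P.eventually_dist_lt ht htT hAc hδ₂]
    with n hqn hnT hXn hAn
  rw [Real.dist_eq, sub_zero]
  calc _ ≤ ∑ k ∈ P.upTo n t, (η * ∑ j, |A (P.pt n (k + 1)) j - A (P.pt n k) j| +
        η * ∑ i, (X (P.pt n (k + 1)) i - X (P.pt n k) i) *
          (X (P.pt n (k + 1)) i - X (P.pt n k) i)) := by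
        refine (Finset.abs_sum_le_sum_abs _ _).trans (Finset.sum_le_sum fun k hk => ?_)
        have hkK : (X (P.pt n k), A (P.pt n k)) ∈ K :=
          ⟨P.pt n k, ⟨P.pt_nonneg n k, ((P.mem_upTo n t k).1 hk).trans htT.le⟩, rfl⟩
        have e₁ := h₁ _ _ hkK _ ((hXn k hk).trans_le (min_le_left _ _))
        have e₂ := h₂ _ _ hkK _ _ ((hXn k hk).trans_le (min_le_right _ _)) (hAn k hk)
        rw [abs_le] at e₁ e₂ ⊢
        constructor <;> linarith [e₁.1, e₁.2, e₂.1, e₂.2]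
    _ = η * (∑ j, ∑ k ∈ P.upTo n t, |A (P.pt n (k + 1)) j - A (P.pt n k) j| +
        ∑ i, covSum P (fun s => X s i) (fun s => X s i) t n) := by
        rw [Finset.sum_add_distrib, ← Finset.mul_sum, ← Finset.mul_sum, ← mul_add,
          Finset.sum_comm, Finset.sum_comm (s := P.upTo n t)]
        rfl
    _ ≤ η * (MA + MX) := by
        refine mul_le_mul_of_nonneg_left (add_le_add ?_ ?_) hη.le
        · exact Finset.sum_le_sum fun j _ => (hA j).sum_abs_sub_le ht hnT
        · exact Finset.sum_le_sum fun i _ => hqn i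
    _ < ε := by
        rw [hηdef, div_mul_eq_mul_div, div_lt_iff₀ (by positivity)]
        nlinarith

/-- The drift density in Itô's formula for `f(X, A)`. -/
def itoDrift (f : (Fin d → ℝ) × (Fin m → ℝ) → ℝ) (X : ℝ → Fin d → ℝ) (q : Fin d → Fin d → ℝ → ℝ)
    (A α : ℝ → Fin m → ℝ) (s : ℝ) : ℝ :=
  fderiv ℝ f (X s, A s) (0, α s) +
    1 / 2 * ∑ i, ∑ j, partialX (partialX f i) j (X s, A s) * q i j s

theorem itoDrift_eq (f : (Fin d → ℝ) × (Fin m → ℝ) → ℝ) (X : ℝ → Fin d → ℝ)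
    (q : Fin d → Fin d → ℝ → ℝ) (A α : ℝ → Fin m → ℝ) :
    itoDrift f X q A α = fun s => ∑ j, fderiv ℝ f (X s, A s) (0, Pi.single j 1) * α s j +
      1 / 2 * ∑ i, ∑ j, partialX (partialX f i) j (X s, A s) * q i j s := by
  funext s
  rw [itoDrift, fderiv_zero_right]

/-- Continuity of the derivatives of `f` along the path, and integrability of the terms of
`itoDrift`. -/
theorem itoDrift_terms (hX : IsQV P X)
    (hq : ∀ i j, HasDensity ν T (covariation P (fun s => X s i) (fun s => X s j)) (q i j))
    (hA : ∀ j, HasDensity ν T (fun t => A t j) (fun t => α t j))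
    (hU : IsOpen U) (hV : IsOpen V) (hf : IsC21 U V f)
    (hXU : ∀ t ∈ Icc 0 T, X t ∈ U) (hAV : ∀ t ∈ Icc 0 T, A t ∈ V)
    {t : ℝ} (ht : 0 ≤ t) (htT : t ≤ T) :
    (∀ j, ContinuousOn (fun s => fderiv ℝ f (X s, A s) (0, Pi.single j 1)) (Icc 0 t)) ∧
    (∀ i j, ContinuousOn (fun s => partialX (partialX f i) j (X s, A s)) (Icc 0 t)) ∧
    (∀ j, IntervalIntegrable (fun s => fderiv ℝ f (X s, A s) (0, Pi.single j 1) * α s j) ν 0 t) ∧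
    (∀ i j, IntervalIntegrable
      (fun s => partialX (partialX f i) j (X s, A s) * q i j s) ν 0 t) := by
  have hsub : Icc 0 t ⊆ Icc 0 T := Icc_subset_Icc_right htT
  have hXc : ContinuousOn X (Icc 0 t) := hX.continuousOn.mono Icc_subset_Ici_self
  have hAc : ContinuousOn A (Icc 0 t) :=
    continuousOn_pi.2 fun j => (hA j).continuousOn.mono hsub
  have hmaps : MapsTo (fun s => (X s, A s)) (Icc 0 t) (U ×ˢ V) := fun s hs =>
    ⟨hXU s (hsub hs), hAV s (hsub hs)⟩
  have h1 : ∀ j, ContinuousOn (fun s => fderiv ℝ f (X s, A s) (0, Pi.single j 1)) (Icc 0 t) :=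
    fun j => ((hf.continuousOn_fderiv hU hV).comp (hXc.prodMk hAc) hmaps).clm_apply
      continuousOn_const
  have h2 : ∀ i j, ContinuousOn (fun s => partialX (partialX f i) j (X s, A s)) (Icc 0 t) :=
    fun i j => (hf.continuousOn_partialX₂ i j).comp (hXc.prodMk hAc) hmaps
  refine ⟨h1, h2, fun j => ?_, fun i j => ?_⟩
  · exact ((hA j).mono_right ⟨ht, htT⟩).integrable.continuousOn_mul
      (by rw [uIcc_of_le ht]; exact h1 j)
  · exact ((hq i j).mono_right ⟨ht, htT⟩).integrable.continuousOn_mul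
      (by rw [uIcc_of_le ht]; exact h2 i j)

theorem intervalIntegrable_itoDrift (hX : IsQV P X)
    (hq : ∀ i j, HasDensity ν T (covariation P (fun s => X s i) (fun s => X s j)) (q i j))
    (hA : ∀ j, HasDensity ν T (fun t => A t j) (fun t => α t j))
    (hU : IsOpen U) (hV : IsOpen V) (hf : IsC21 U V f)
    (hXU : ∀ t ∈ Icc 0 T, X t ∈ U) (hAV : ∀ t ∈ Icc 0 T, A t ∈ V)
    {t : ℝ} (ht : 0 ≤ t) (htT : t ≤ T) : IntervalIntegrable (itoDrift f X q A α) ν 0 t := by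
  obtain ⟨-, -, h3, h4⟩ := itoDrift_terms hX hq hA hU hV hf hXU hAV ht htT
  rw [itoDrift_eq]
  exact (intervalIntegrable_finsetSum fun j _ => h3 j).add
    ((intervalIntegrable_finsetSum fun i _ => intervalIntegrable_finsetSum fun j _ =>
      h4 i j).const_mul _)

/-- **Föllmer's Itô formula**: the Föllmer integral of `∇_x f(X, A)` against `X` exists. -/
theorem tendsto_follmerSum_partialX (hX : IsQV P X)
    (hq : ∀ i j, HasDensity ν T (covariation P (fun s => X s i) (fun s => X s j)) (q i j))
    (hA : ∀ j, HasDensity ν T (fun t => A t j) (fun t => α t j))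
    (hU : IsOpen U) (hV : IsOpen V) (hf : IsC21 U V f)
    (hXU : ∀ t ∈ Icc 0 T, X t ∈ U) (hAV : ∀ t ∈ Icc 0 T, A t ∈ V)
    {t : ℝ} (ht : 0 ≤ t) (htT : t < T) :
    Tendsto (follmerSum P (fun s i => partialX f i (X s, A s)) X t) atTop
      (𝓝 (f (X t, A t) - f (X 0, A 0) - ∫ s in (0 : ℝ)..t, itoDrift f X q A α s ∂ν)) := by
  obtain ⟨h1, h2, h3, h4⟩ :=
    itoDrift_terms hX hq hA hU hV hf hXU hAV ht htT.le
  have hXc : ContinuousOn X (Icc 0 T) := hX.continuousOn.mono Icc_subset_Ici_self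
  have hAc : ContinuousOn A (Icc 0 T) := continuousOn_pi.2 fun j => (hA j).continuousOn
  have hfc : ContinuousOn (fun s => f (X s, A s)) (Icc 0 T) :=
    hf.contDiffOn.continuousOn.comp (hXc.prodMk hAc) fun s hs => ⟨hXU s hs, hAV s hs⟩
  have hint : ∫ s in (0 : ℝ)..t, itoDrift f X q A α s ∂ν =
      ∑ j, (∫ s in (0 : ℝ)..t, fderiv ℝ f (X s, A s) (0, Pi.single j 1) * α s j ∂ν) +
      1 / 2 * ∑ i, ∑ j, ∫ s in (0 : ℝ)..t, partialX (partialX f i) j (X s, A s) * q i j s ∂ν := by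
    rw [itoDrift_eq, intervalIntegral.integral_add (intervalIntegrable_finsetSum fun j _ => h3 j)
      ((intervalIntegrable_finsetSum fun i _ => intervalIntegrable_finsetSum fun j _ =>
        h4 i j).const_mul _), intervalIntegral.integral_finsetSum fun j _ => h3 j,
      intervalIntegral.integral_const_mul, intervalIntegral.integral_finsetSum fun i _ =>
        intervalIntegrable_finsetSum fun j _ => h4 i j]
    simp only [intervalIntegral.integral_finsetSum fun j _ => h4 _ j]
  have hlim := ((P.tendsto_sum_sub ht htT hfc).sub ((tendsto_finsetSum Finset.univ fun j _ =>
    (hA j).tendsto_sum (P := P) ht htT (h1 j)).add ((tendsto_finsetSum Finset.univ fun i _ =>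
      tendsto_finsetSum Finset.univ fun j _ =>
        hX.tendsto_sum (hq i j) ht htT.le (h2 i j)).const_mul (1 / 2)))).sub
    (tendsto_ito_remainder hX hA hU hV hf hXU hAV ht htT)
  rw [hint]
  rw [sub_zero] at hlim
  refine hlim.congr fun n => ?_
  have e0 : ∀ k, fderiv ℝ f (X (P.pt n k), A (P.pt n k)) (0, A (P.pt n (k + 1)) - A (P.pt n k)) =
      ∑ j, fderiv ℝ f (X (P.pt n k), A (P.pt n k)) (0, Pi.single j 1) *
        (A (P.pt n (k + 1)) - A (P.pt n k)) j := fun k => fderiv_zero_right _ _ _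
  simp only [follmerSum, dotProduct, Pi.sub_apply, e0]
  simp only [Finset.sum_sub_distrib, ← Finset.mul_sum]
  rw [Finset.sum_comm (s := P.upTo n t) (f := fun k j =>
    fderiv ℝ f (X (P.pt n k), A (P.pt n k)) (0, Pi.single j 1) *
      (A (P.pt n (k + 1)) j - A (P.pt n k) j))]
  have e : ∑ k ∈ P.upTo n t, ∑ i, ∑ j, partialX (partialX f i) j (X (P.pt n k), A (P.pt n k)) *
      ((X (P.pt n (k + 1)) i - X (P.pt n k) i) * (X (P.pt n (k + 1)) j - X (P.pt n k) j)) =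
      ∑ i, ∑ j, ∑ k ∈ P.upTo n t, partialX (partialX f i) j (X (P.pt n k), A (P.pt n k)) *
      ((X (P.pt n (k + 1)) i - X (P.pt n k) i) * (X (P.pt n (k + 1)) j - X (P.pt n k) j)) := by
    rw [Finset.sum_comm]
    exact Finset.sum_congr rfl fun i _ => Finset.sum_comm
  rw [e]
  ring

end Ito

/-! ### Logarithmic change of variables and exponentials in the class `C^{2,1}` -/

section Log

variable {d n : ℕ}

/-- The componentwise logarithm on `ℝ^d`. -/
def logVec (x : Fin d → ℝ) : Fin d → ℝ := fun i => Real.log (x i)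

/-- The open set of all `x ∈ (0, ∞)^d` with `log x ∈ U`. -/
def logPreimage (U : Set (Fin d → ℝ)) : Set (Fin d → ℝ) := {x | (∀ i, 0 < x i) ∧ logVec x ∈ U}

theorem continuousOn_logVec : ContinuousOn (logVec (d := d)) {x | ∀ i, 0 < x i} :=
  continuousOn_pi.2 fun i => (continuous_apply i).continuousOn.log fun _ hx => (hx i).ne'

theorem isOpen_logPreimage {U : Set (Fin d → ℝ)} (hU : IsOpen U) : IsOpen (logPreimage U) := by
  have h : IsOpen {x : Fin d → ℝ | ∀ i, 0 < x i} := by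
    simp only [ofPred_forall]
    exact isOpen_iInter_of_finite fun i => isOpen_lt continuous_const (continuous_apply i)
  exact continuousOn_logVec.isOpen_inter_preimage h hU

theorem hasFDerivAt_logVec {x : Fin d → ℝ} (hx : ∀ i, 0 < x i) :
    HasFDerivAt logVec (ContinuousLinearMap.pi fun i =>
      (x i)⁻¹ • ContinuousLinearMap.proj (R := ℝ) (φ := fun _ : Fin d => ℝ) i) x :=
  hasFDerivAt_pi.2 fun i => (hasFDerivAt_apply i x).log (hx i).ne'

theorem _root_.HasFDerivAt.comp_logVec {F : (Fin d → ℝ) → ℝ} {v x : Fin d → ℝ}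
    (hx : ∀ i, 0 < x i) (h : HasFDerivAt F (gradCLM v) (logVec x)) :
    HasFDerivAt (fun y => F (logVec y)) (gradCLM fun k => v k * (x k)⁻¹) x := by
  refine (h.comp x (hasFDerivAt_logVec hx)).congr_fderiv ?_
  ext y
  simp [gradCLM_apply, mul_assoc]

/-- If `f` is of class `C^{2,1}`, then so is `(x, a) ↦ f(log x, a)`. -/
theorem IsC21.comp_log {U : Set (Fin d → ℝ)} {V : Set (Fin n → ℝ)}
    {f : (Fin d → ℝ) × (Fin n → ℝ) → ℝ} (hf : IsC21 U V f) (hU : IsOpen U) (hV : IsOpen V) :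
    IsC21 (logPreimage U) V (fun p => f (logVec p.1, p.2)) ∧
      ∀ p ∈ logPreimage U ×ˢ V, ∀ k, partialX (fun p => f (logVec p.1, p.2)) k p =
        partialX f k (logVec p.1, p.2) * (p.1 k)⁻¹ := by
  have hmaps : MapsTo (fun p : (Fin d → ℝ) × (Fin n → ℝ) => (logVec p.1, p.2))
      (logPreimage U ×ˢ V) (U ×ˢ V) := fun p hp => ⟨hp.1.2, hp.2⟩
  have hlog : ContDiffOn ℝ 1 (fun p : (Fin d → ℝ) × (Fin n → ℝ) => (logVec p.1, p.2))
      (logPreimage U ×ˢ V) := by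
    refine ContDiffOn.prodMk (contDiffOn_pi.2 fun i => ?_) contDiff_snd.contDiffOn
    exact ContDiffOn.log (by fun_prop) fun p hp => (hp.1.1 i).ne'
  have hinv : ∀ k, ContinuousOn (fun p : (Fin d → ℝ) × (Fin n → ℝ) => (p.1 k)⁻¹)
      (logPreimage U ×ˢ V) := fun k =>
    ContinuousOn.inv₀ (by fun_prop) fun p hp => (hp.1.1 k).ne'
  have h := IsC21.of_hasFDerivAt (V := V) (f := fun p => f (logVec p.1, p.2))
    (D := fun k p => partialX f k (logVec p.1, p.2) * (p.1 k)⁻¹)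
    (D₂ := fun k m p => partialX (partialX f k) m (logVec p.1, p.2) * (p.1 m)⁻¹ * (p.1 k)⁻¹ +
      partialX f k (logVec p.1, p.2) * (if m = k then -((p.1 k)⁻¹ * (p.1 k)⁻¹) else 0))
    (isOpen_logPreimage hU) (hf.contDiffOn.comp hlog hmaps)
    (fun x hx a ha => (hf.hasFDerivAt_left hU hV hx.2 ha).comp_logVec hx.1) ?_ ?_
  · exact ⟨h.1, fun p hp k => (h.2 p hp k).1⟩
  · intro k x hx a ha
    have h1 := (hf.hasFDerivAt_partialX hU hx.2 ha k).comp_logVec hx.1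
    have h2 := (hasDerivAt_inv (hx.1 k).ne').comp_hasFDerivAt x (hasFDerivAt_apply (𝕜 := ℝ) k x)
    refine (h1.mul h2).congr_fderiv ?_
    ext y
    simp only [gradCLM_apply, add_mul, mul_ite, mul_zero, ite_mul, zero_mul,
      Finset.sum_add_distrib, Finset.sum_ite_eq', Finset.mem_univ, if_true]
    simp [gradCLM_apply, Finset.mul_sum]
    rw [add_comm]
    congr 1
    · exact Finset.sum_congr rfl fun m _ => by ring
    · ring
  · intro k m
    have hc := hlog.continuousOn
    refine ((((hf.continuousOn_partialX₂ k m).comp hc hmaps).mul (hinv m)).mul (hinv k)).add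
      (((hf.continuousOn_partialX hU hV k).comp hc hmaps).mul ?_)
    split_ifs
    · exact ((hinv k).mul (hinv k)).neg
    · exact continuousOn_const

end Log

section Exp

variable {d n : ℕ}

/-- The function `(x, (c, a)) ↦ exp(g(x, a) + c)`. -/
def expShift (g : (Fin d → ℝ) × (Fin n → ℝ) → ℝ) (p : (Fin d → ℝ) × (Fin (n + 1) → ℝ)) : ℝ :=
  Real.exp (g (p.1, Fin.tail p.2) + p.2 0)

/-- Dropping the first coordinate, as a linear map. -/
def tailCLM : (Fin (n + 1) → ℝ) →L[ℝ] (Fin n → ℝ) :=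
  ContinuousLinearMap.pi fun j => ContinuousLinearMap.proj j.succ

theorem tailCLM_apply (b : Fin (n + 1) → ℝ) : tailCLM b = Fin.tail b := rfl

theorem continuous_tail : Continuous (Fin.tail : (Fin (n + 1) → ℝ) → Fin n → ℝ) :=
  (tailCLM (n := n)).continuous

variable {U : Set (Fin d → ℝ)} {V : Set (Fin n → ℝ)} {g : (Fin d → ℝ) × (Fin n → ℝ) → ℝ}

/-- If `g` is of class `C^{2,1}`, then so is `exp(g + c)`, with a real parameter `c` adjoined. -/
theorem IsC21.expShift (hg : IsC21 U V g) (hU : IsOpen U) (hV : IsOpen V) :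
    IsC21 U (Fin.tail ⁻¹' V) (expShift g) ∧ ∀ p ∈ U ×ˢ (Fin.tail ⁻¹' V), ∀ k,
      partialX (Follmer.expShift g) k p =
        partialX g k (p.1, Fin.tail p.2) * Follmer.expShift g p ∧
      ∀ m, partialX (partialX (Follmer.expShift g) k) m p =
        (partialX (partialX g k) m (p.1, Fin.tail p.2) + partialX g k (p.1, Fin.tail p.2) *
          partialX g m (p.1, Fin.tail p.2)) * Follmer.expShift g p := by
  have hmaps : MapsTo (fun p : (Fin d → ℝ) × (Fin (n + 1) → ℝ) => (p.1, Fin.tail p.2))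
      (U ×ˢ (Fin.tail ⁻¹' V)) (U ×ˢ V) := fun p hp => ⟨hp.1, hp.2⟩
  have htail : ContDiff ℝ 1
      (fun p : (Fin d → ℝ) × (Fin (n + 1) → ℝ) => (p.1, Fin.tail p.2)) :=
    contDiff_fst.prodMk ((tailCLM (n := n)).contDiff.comp contDiff_snd)
  have hc : ContDiffOn ℝ 1 (Follmer.expShift g) (U ×ˢ (Fin.tail ⁻¹' V)) :=
    ((hg.contDiffOn.comp htail.contDiffOn hmaps).add (by fun_prop)).exp
  have hD : ∀ x ∈ U, ∀ a ∈ (Fin.tail ⁻¹' V : Set (Fin (n + 1) → ℝ)),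
      HasFDerivAt (fun y => Follmer.expShift g (y, a))
        (gradCLM fun k => partialX g k (x, Fin.tail a) * Follmer.expShift g (x, a)) x := by
    intro x hx a ha
    refine (((hg.hasFDerivAt_left hU hV hx ha).add_const (a 0)).exp).congr_fderiv ?_
    ext y
    simp only [_root_.smul_apply, gradCLM_apply, smul_eq_mul, Finset.mul_sum,
      Follmer.expShift]
    exact Finset.sum_congr rfl fun m _ => by ring
  refine IsC21.of_hasFDerivAt hU hc hD (fun k x hx a ha => ?_) fun k m => ?_
  · refine ((hg.hasFDerivAt_partialX hU hx ha k).mul (hD x hx a ha)).congr_fderiv ?_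
    ext y
    simp only [_root_.smul_apply, _root_.add_apply, gradCLM_apply,
      smul_eq_mul, Finset.mul_sum, ← Finset.sum_add_distrib]
    exact Finset.sum_congr rfl fun m _ => by ring
  · have hcont := htail.continuous.continuousOn (s := U ×ˢ (Fin.tail ⁻¹' V))
    exact (((hg.continuousOn_partialX₂ k m).comp hcont hmaps).add
      (((hg.continuousOn_partialX hU hV k).comp hcont hmaps).mul
        ((hg.continuousOn_partialX hU hV m).comp hcont hmaps))).mul hc.continuousOn

theorem IsC21.fderiv_expShift (hg : IsC21 U V g) (hU : IsOpen U) (hV : IsOpen V)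
    {p : (Fin d → ℝ) × (Fin (n + 1) → ℝ)} (hp : p ∈ U ×ˢ (Fin.tail ⁻¹' V))
    (b : Fin (n + 1) → ℝ) :
    fderiv ℝ (Follmer.expShift g) p (0, b) =
      Follmer.expShift g p * (fderiv ℝ g (p.1, Fin.tail p.2) (0, Fin.tail b) + b 0) := by
  have h1 : HasFDerivAt (fun p : (Fin d → ℝ) × (Fin (n + 1) → ℝ) => (p.1, Fin.tail p.2))
      ((ContinuousLinearMap.fst ℝ _ _).prod
        ((tailCLM (n := n)).comp (ContinuousLinearMap.snd ℝ _ _))) p :=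
    hasFDerivAt_fst.prodMk (tailCLM.hasFDerivAt.comp p hasFDerivAt_snd)
  have h2 : HasFDerivAt (fun p : (Fin d → ℝ) × (Fin (n + 1) → ℝ) => p.2 0)
      ((ContinuousLinearMap.proj (R := ℝ) (φ := fun _ : Fin (n + 1) => ℝ) 0).comp
        (ContinuousLinearMap.snd ℝ (Fin d → ℝ) (Fin (n + 1) → ℝ))) p :=
    HasFDerivAt.comp (g := fun b : Fin (n + 1) → ℝ => b 0) p (hasFDerivAt_apply 0 p.2)
      (hasFDerivAt_snd (𝕜 := ℝ) (p := p))
  have h3 : HasFDerivAt (Follmer.expShift g) _ p := (((hg.differentiableAt hU hV (p := (p.1, Fin.tail p.2))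
    ⟨hp.1, hp.2⟩).hasFDerivAt.comp p h1).add h2).exp
  rw [h3.fderiv]
  simp [tailCLM_apply, Follmer.expShift, mul_add]

end Exp

/-! ### The portfolio value on a compact interval -/

/-- The data needed to compute the portfolio value on `[0, T]`: a representation
`π / S = ∇_x g(S, A)`, and densities, with respect to one atomless measure `ν`, of the covariations
of `S` (`q`), of `A` (`α`) and of the logarithmic bond price (`ρ`). -/
structure PortfolioRep {d n : ℕ} (P : PartitionSeq) (r : ℝ → ℝ) (S π : ℝ → Fin d → ℝ) (T : ℝ)
    (U : Set (Fin d → ℝ)) (V : Set (Fin n → ℝ)) (g : (Fin d → ℝ) × (Fin n → ℝ) → ℝ)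
    (A α : ℝ → Fin n → ℝ) (ν : Measure ℝ) (q : Fin d → Fin d → ℝ → ℝ) (ρ : ℝ → ℝ) : Prop where
  isOpen_left : IsOpen U
  isOpen_right : IsOpen V
  isC21 : IsC21 U V g
  mem_left : ∀ t ∈ Icc 0 T, S t ∈ U
  mem_right : ∀ t ∈ Icc 0 T, A t ∈ V
  quot_eq : ∀ t ∈ Icc 0 T, ∀ k, π t k / S t k = partialX g k (S t, A t)
  noAtoms : NullSingletonClass ν
  density_cov : ∀ i j, HasDensity ν T (covariation P (fun s => S s i) (fun s => S s j)) (q i j)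
  density_param : ∀ j, HasDensity ν T (fun t => A t j) (fun t => α t j)
  density_rate : HasDensity ν T (fun t => ∫ s in (0 : ℝ)..t, r s) ρ

theorem hasDensity_rate {r : ℝ → ℝ} (hr : ∀ T : ℝ, 0 < T → IntegrableOn r (Icc 0 T) volume)
    {T : ℝ} (hT : 0 < T) : HasDensity volume T (fun t => ∫ s in (0 : ℝ)..t, r s) r where
  integrable := by
    rw [intervalIntegrable_iff_integrableOn_Icc_of_le hT.le]
    exact hr T hT
  eq t _ := by simp

/-- An admissible integrand for `log S`, divided by `S`, is the gradient of a `C^{2,1}` function of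
`S` and of a continuous parameter of bounded variation. -/
theorem exists_quotPath_rep {d : ℕ} {S π : ℝ → Fin d → ℝ} (hSpos : ∀ t, 0 ≤ t → ∀ i, 0 < S t i)
    (hπ : IsAdmissible (logPath S) π) {T : ℝ} (hT : 0 < T) :
    ∃ (n : ℕ) (U : Set (Fin d → ℝ)) (V : Set (Fin n → ℝ))
      (g : (Fin d → ℝ) × (Fin n → ℝ) → ℝ) (A : ℝ → Fin n → ℝ),
      IsOpen U ∧ IsOpen V ∧ IsC21 U V g ∧ IsCBV T V A ∧
        ∀ t ∈ Icc 0 T, S t ∈ U ∧ ∀ k, quotPath π S t k = partialX g k (S t, A t) := by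
  obtain ⟨n, U, V, f, A, hU, hV, hf, hA, h⟩ := hπ T hT
  obtain ⟨hg, hg'⟩ := hf.comp_log hU hV
  have hmem : ∀ t ∈ Icc 0 T, S t ∈ logPreimage U := fun t ht => ⟨hSpos t ht.1, (h t ht).1⟩
  refine ⟨n, logPreimage U, V, _, A, isOpen_logPreimage hU, hV, hg, hA, fun t ht =>
    ⟨hmem t ht, fun k => ?_⟩⟩
  rw [hg' (S t, A t) ⟨hmem t ht, hA.mapsTo ht⟩ k, quotPath, (h t ht).2 k, div_eq_mul_inv]
  rfl

theorem exists_portfolioRep {d : ℕ} {P : PartitionSeq} {r : ℝ → ℝ}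
    (hr : ∀ T : ℝ, 0 < T → IntegrableOn r (Icc 0 T) volume) {S : ℝ → Fin d → ℝ} (hS : IsQV P S)
    (hSpos : ∀ t, 0 ≤ t → ∀ i, 0 < S t i) {π : ℝ → Fin d → ℝ}
    (hπ : IsAdmissible (logPath S) π) {T : ℝ} (hT : 0 < T) :
    ∃ (n : ℕ) (U : Set (Fin d → ℝ)) (V : Set (Fin n → ℝ))
      (g : (Fin d → ℝ) × (Fin n → ℝ) → ℝ) (A α : ℝ → Fin n → ℝ) (ν : Measure ℝ)
      (q : Fin d → Fin d → ℝ → ℝ) (ρ : ℝ → ℝ), PortfolioRep P r S π T U V g A α ν q ρ := by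
  obtain ⟨n, U, V, g, A, hU, hV, hg, hA, h⟩ := exists_quotPath_rep hSpos hπ hT
  have hR := hasDensity_rate hr hT
  -- All integrators needed on `[0, T]`, so that one measure `ν` serves for all of them.
  let F : (Fin d × Fin d) ⊕ (Fin n ⊕ Unit) → ℝ → ℝ := Sum.elim
    (fun ij => covariation P (fun s => S s ij.1) (fun s => S s ij.2))
    (Sum.elim (fun j t => A t j) fun _ t => ∫ s in (0 : ℝ)..t, r s)
  obtain ⟨ν, -, hν, φ, hφ⟩ := exists_common_density hT.le F
    (by
      rintro (ij | j | _)
      · exact (hS.continuousOn_cov ij.1 ij.2).mono Icc_subset_Ici_self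
      · exact continuousOn_pi.1 hA.continuousOn j
      · exact hR.continuousOn)
    (by
      rintro (ij | j | _)
      · exact hS.boundedVariationOn_covariation ij.1 ij.2 T
      · exact hA.boundedVariationOn j
      · exact hR.boundedVariationOn)
  exact ⟨n, U, V, g, A, fun t j => φ (Sum.inr (Sum.inl j)) t, ν, fun i j => φ (Sum.inl (i, j)),
    φ (Sum.inr (Sum.inr ())), hU, hV, hg, fun t ht => (h t ht).1, hA.mapsTo,
    fun t ht => (h t ht).2, hν, fun i j => hφ (Sum.inl (i, j)),
    fun j => hφ (Sum.inr (Sum.inl j)), hφ (Sum.inr (Sum.inr ()))⟩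

/-- An exponential `exp F` of a function with density `φ` has density `exp F · φ`: this is Itô's
formula for a path with values in `ℝ^0`. -/
theorem HasDensity.exp (P : PartitionSeq) {ν : Measure ℝ} [NullSingletonClass ν] {T t : ℝ}
    {F φ : ℝ → ℝ} (hF : HasDensity ν T F φ) (ht : 0 ≤ t) (htT : t < T) :
    HasDensity ν t (fun s => Real.exp (F s)) (fun s => Real.exp (F s) * φ s) where
  integrable := (hF.mono_right ⟨ht, htT.le⟩).integrable.continuousOn_mul
    (by rw [uIcc_of_le ht]; exact (hF.mono_right ⟨ht, htT.le⟩).continuousOn.rexp)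
  eq := by
    intro s hs
    have h0 : IsC21 (univ : Set (Fin 0 → ℝ)) (univ : Set (Fin 0 → ℝ)) (fun _ => (0 : ℝ)) :=
      ⟨contDiffOn_const, fun k => k.elim0, fun k => k.elim0⟩
    have hX : IsQV P (fun _ => (0 : Fin 0 → ℝ)) :=
      ⟨continuousOn_const, fun i => i.elim0, fun i => i.elim0⟩
    have h := tendsto_follmerSum_partialX (P := P) (ν := ν) (T := T)
      (q := fun i _ => i.elim0) (A := fun s _ => F s) (α := fun s _ => φ s) hX
      (fun i => i.elim0) (fun _ => hF) isOpen_univ (isOpen_univ.preimage continuous_tail)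
      (h0.expShift isOpen_univ isOpen_univ).1 (fun _ _ => mem_univ _) (fun _ _ => mem_univ _)
      hs.1 (hs.2.trans_lt htT)
    have h1 : ∀ x, itoDrift (expShift fun _ => (0 : ℝ)) (fun _ => (0 : Fin 0 → ℝ))
        (fun i _ => i.elim0) (fun s (_ : Fin 1) => F s) (fun s _ => φ s) x =
          Real.exp (F x) * φ x := fun x => by
      rw [itoDrift, h0.fderiv_expShift isOpen_univ isOpen_univ ⟨mem_univ _, mem_univ _⟩]
      simp [expShift]
    simp only [h1] at h
    have h2 : follmerSum P (fun s i => partialX (expShift fun _ => (0 : ℝ)) i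
        ((0 : Fin 0 → ℝ), fun _ : Fin 1 => F s)) (fun _ => 0) s = fun _ => 0 := by
      funext n
      simp [follmerSum]
    rw [h2] at h
    have h3 := tendsto_nhds_unique h tendsto_const_nhds
    simp only [expShift, zero_add] at h3
    linarith

namespace PortfolioRep

variable {d n : ℕ} {P : PartitionSeq} {r : ℝ → ℝ} {S π : ℝ → Fin d → ℝ} {T t : ℝ}
  {U : Set (Fin d → ℝ)} {V : Set (Fin n → ℝ)} {g : (Fin d → ℝ) × (Fin n → ℝ) → ℝ}
  {A α : ℝ → Fin n → ℝ} {ν : Measure ℝ} {q : Fin d → Fin d → ℝ → ℝ} {ρ : ℝ → ℝ}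

theorem continuousOn_param (h : PortfolioRep P r S π T U V g A α ν q ρ) :
    ContinuousOn A (Icc 0 T) :=
  have := h.noAtoms
  continuousOn_pi.2 fun j => (h.density_param j).continuousOn

theorem continuousOn_path (h : PortfolioRep P r S π T U V g A α ν q ρ) (hS : IsQV P S) :
    ContinuousOn (fun s => (S s, A s)) (Icc 0 T) :=
  (hS.continuousOn.mono Icc_subset_Ici_self).prodMk h.continuousOn_param

theorem continuousOn_quot (h : PortfolioRep P r S π T U V g A α ν q ρ) (hS : IsQV P S)
    (k : Fin d) : ContinuousOn (fun s => π s k / S s k) (Icc 0 T) :=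
  ((h.isC21.continuousOn_partialX h.isOpen_left h.isOpen_right k).comp (h.continuousOn_path hS)
    fun s hs => ⟨h.mem_left s hs, h.mem_right s hs⟩).congr fun s hs => h.quot_eq s hs k

theorem continuousOn_cash (h : PortfolioRep P r S π T U V g A α ν q ρ) (hS : IsQV P S)
    (hSpos : ∀ t, 0 ≤ t → ∀ i, 0 < S t i) : ContinuousOn (fun s => 1 - ∑ i, π s i) (Icc 0 T) := by
  refine continuousOn_const.sub (continuousOn_finsetSum _ fun i _ => ?_)
  refine ((h.continuousOn_quot hS i).mul
    ((continuousOn_pi.1 hS.continuousOn i).mono Icc_subset_Ici_self)).congr fun s hs => ?_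
  exact (div_mul_cancel₀ _ (hSpos s hs.1 i).ne').symm

theorem continuousOn_covIntegrand (h : PortfolioRep P r S π T U V g A α ν q ρ) (hS : IsQV P S)
    (i j : Fin d) : ContinuousOn (covIntegrand S π i j) (Icc 0 T) :=
  ((h.continuousOn_quot hS i).mul (h.continuousOn_quot hS j)).congr fun s _ =>
    (div_mul_div_comm (π s i) (S s i) (π s j) (S s j)).symm

theorem hasRSIntegral_covIntegrand (h : PortfolioRep P r S π T U V g A α ν q ρ)
    (hS : IsQV P S) (ht : t ∈ Icc 0 T) (i j : Fin d) :
    HasRSIntegral (covIntegrand S π i j) (covariation P (fun s => S s i) (fun s => S s j)) 0 t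
      (∫ s in (0 : ℝ)..t, covIntegrand S π i j s * q i j s ∂ν) :=
  ((h.density_cov i j).mono_right ht).hasRSIntegral ht.1
    ((h.continuousOn_covIntegrand hS i j).mono (Icc_subset_Icc_right ht.2))

theorem intervalIntegrable_covIntegrand (h : PortfolioRep P r S π T U V g A α ν q ρ)
    (hS : IsQV P S) (hT : 0 ≤ T) (i j : Fin d) :
    IntervalIntegrable (fun s => covIntegrand S π i j s * q i j s) ν 0 T :=
  (h.density_cov i j).integrable.continuousOn_mul
    (by rw [uIcc_of_le hT]; exact h.continuousOn_covIntegrand hS i j)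

theorem intervalIntegrable_cash (h : PortfolioRep P r S π T U V g A α ν q ρ)
    (hS : IsQV P S) (hSpos : ∀ t, 0 ≤ t → ∀ i, 0 < S t i) (hT : 0 ≤ T) :
    IntervalIntegrable (fun s => (1 - ∑ i, π s i) * ρ s) ν 0 T :=
  h.density_rate.integrable.continuousOn_mul
    (by rw [uIcc_of_le hT]; exact h.continuousOn_cash hS hSpos)

theorem intervalIntegrable_bondIntegrand (h : PortfolioRep P r S π T U V g A α ν q ρ)
    (hr : ∀ T : ℝ, 0 < T → IntegrableOn r (Icc 0 T) volume)
    (hS : IsQV P S) (hSpos : ∀ t, 0 ≤ t → ∀ i, 0 < S t i) (hT : 0 < T) :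
    IntervalIntegrable (bondIntegrand r π) volume 0 T :=
  (hasDensity_rate hr hT).integrable.continuousOn_mul
    (by rw [uIcc_of_le hT.le]; exact h.continuousOn_cash hS hSpos)

/-- Both sides are the Riemann–Stieltjes integral of `1 - ∑ π_i` against `∫ r`. -/
theorem integral_bondIntegrand (h : PortfolioRep P r S π T U V g A α ν q ρ)
    (hr : ∀ T : ℝ, 0 < T → IntegrableOn r (Icc 0 T) volume)
    (hS : IsQV P S) (hSpos : ∀ t, 0 ≤ t → ∀ i, 0 < S t i) (hT : 0 < T) (ht : t ∈ Icc 0 T) :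
    ∫ s in (0 : ℝ)..t, bondIntegrand r π s =
      ∫ s in (0 : ℝ)..t, (1 - ∑ i, π s i) * ρ s ∂ν := by
  have hc := (h.continuousOn_cash hS hSpos).mono (Icc_subset_Icc_right ht.2)
  exact (((hasDensity_rate hr hT).mono_right ht).hasRSIntegral ht.1 hc).unique ht.1
    ((h.density_rate.mono_right ht).hasRSIntegral ht.1 hc)

theorem tendsto_follmerSum_quotPath (h : PortfolioRep P r S π T U V g A α ν q ρ)
    (hS : IsQV P S) (ht : 0 ≤ t) (htT : t < T) :
    Tendsto (follmerSum P (quotPath π S) S t) atTop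
      (𝓝 (g (S t, A t) - g (S 0, A 0) - ∫ s in (0 : ℝ)..t, itoDrift g S q A α s ∂ν)) := by
  have := h.noAtoms
  rw [follmerSum_congr P (ξ := quotPath π S) (ξ' := fun s i => partialX g i (S s, A s)) fun s hs => funext fun k =>
    h.quot_eq s ⟨hs.1, hs.2.trans htT.le⟩ k]
  exact tendsto_follmerSum_partialX hS h.density_cov h.density_param h.isOpen_left h.isOpen_right
    h.isC21 h.mem_left h.mem_right ht htT

/-- The density of `log V^π - g(S, A)`. -/
def logDrift {d n : ℕ} (S π : ℝ → Fin d → ℝ) (g : (Fin d → ℝ) × (Fin n → ℝ) → ℝ)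
    (A α : ℝ → Fin n → ℝ) (q : Fin d → Fin d → ℝ → ℝ) (ρ : ℝ → ℝ) (s : ℝ) : ℝ :=
  (1 - ∑ i, π s i) * ρ s - itoDrift g S q A α s -
    1 / 2 * ∑ i, ∑ j, covIntegrand S π i j s * q i j s

theorem intervalIntegrable_logDrift (h : PortfolioRep P r S π T U V g A α ν q ρ)
    (hS : IsQV P S) (hSpos : ∀ t, 0 ≤ t → ∀ i, 0 < S t i) (hT : 0 ≤ T) :
    IntervalIntegrable (logDrift S π g A α q ρ) ν 0 T := by
  have := h.noAtoms
  exact ((h.intervalIntegrable_cash hS hSpos hT).sub (intervalIntegrable_itoDrift hS h.density_cov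
    h.density_param h.isOpen_left h.isOpen_right h.isC21 h.mem_left h.mem_right hT le_rfl)).sub
    ((intervalIntegrable_finsetSum fun i _ => intervalIntegrable_finsetSum fun j _ =>
      h.intervalIntegrable_covIntegrand hS hT i j).const_mul _)

/-- The parameter `(C, A)` with `V^π = exp(g(S, A) + C)`. -/
def extParam {d n : ℕ} (S π : ℝ → Fin d → ℝ) (g : (Fin d → ℝ) × (Fin n → ℝ) → ℝ)
    (A α : ℝ → Fin n → ℝ) (ν : Measure ℝ) (q : Fin d → Fin d → ℝ → ℝ) (ρ : ℝ → ℝ) (t : ℝ) :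
    Fin (n + 1) → ℝ :=
  Fin.cons (-g (S 0, A 0) + ∫ s in (0 : ℝ)..t, logDrift S π g A α q ρ s ∂ν) (A t)

/-- The density of `extParam`. -/
def extDensity {d n : ℕ} (S π : ℝ → Fin d → ℝ) (g : (Fin d → ℝ) × (Fin n → ℝ) → ℝ)
    (A α : ℝ → Fin n → ℝ) (q : Fin d → Fin d → ℝ → ℝ) (ρ : ℝ → ℝ) (t : ℝ) : Fin (n + 1) → ℝ :=
  Fin.cons (logDrift S π g A α q ρ t) (α t)

theorem hasDensity_extParam (h : PortfolioRep P r S π T U V g A α ν q ρ)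
    (hS : IsQV P S) (hSpos : ∀ t, 0 ≤ t → ∀ i, 0 < S t i) (hT : 0 ≤ T) (j : Fin (n + 1)) :
    HasDensity ν T (fun t => extParam S π g A α ν q ρ t j)
      (fun t => extDensity S π g A α q ρ t j) := by
  refine Fin.cases ?_ (fun j => ?_) j
  · refine ⟨h.intervalIntegrable_logDrift hS hSpos hT, fun t _ => ?_⟩
    simp [extParam, extDensity]
  · exact h.density_param j

theorem extParam_mem (h : PortfolioRep P r S π T U V g A α ν q ρ) (ht : t ∈ Icc 0 T) :
    extParam S π g A α ν q ρ t ∈ (Fin.tail ⁻¹' V : Set (Fin (n + 1) → ℝ)) :=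
  h.mem_right t ht

/-- The portfolio value is a `C^{2,1}` function of `S` and of the extended parameter. -/
theorem portfolioValue_eq (h : PortfolioRep P r S π T U V g A α ν q ρ)
    (hr : ∀ T : ℝ, 0 < T → IntegrableOn r (Icc 0 T) volume)
    (hS : IsQV P S) (hSpos : ∀ t, 0 ≤ t → ∀ i, 0 < S t i) (ht : 0 ≤ t) (htT : t < T) :
    portfolioValue P r S π t = expShift g (S t, extParam S π g A α ν q ρ t) := by
  have := h.noAtoms
  have hT : 0 < T := ht.trans_lt htT
  have ht' : t ∈ Icc 0 T := ⟨ht, htT.le⟩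
  have hmono : ∀ {ψ : ℝ → ℝ}, IntervalIntegrable ψ ν 0 T → IntervalIntegrable ψ ν 0 t :=
    fun hψ => hψ.mono_set (uIcc_subset_uIcc left_mem_uIcc (by rwa [uIcc_of_le hT.le]))
  have hcov := fun i j => hmono (h.intervalIntegrable_covIntegrand hS hT.le i j)
  have hC : ∫ s in (0 : ℝ)..t, logDrift S π g A α q ρ s ∂ν =
      (∫ s in (0 : ℝ)..t, (1 - ∑ i, π s i) * ρ s ∂ν) -
      (∫ s in (0 : ℝ)..t, itoDrift g S q A α s ∂ν) -
      1 / 2 * ∑ i, ∑ j, ∫ s in (0 : ℝ)..t, covIntegrand S π i j s * q i j s ∂ν := by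
    have h1 := hmono (h.intervalIntegrable_cash hS hSpos hT.le)
    have h2 := intervalIntegrable_itoDrift hS h.density_cov
      h.density_param h.isOpen_left h.isOpen_right h.isC21 h.mem_left h.mem_right ht htT.le
    unfold logDrift
    rw [intervalIntegral.integral_sub (h1.sub h2) ((intervalIntegrable_finsetSum fun i _ =>
      intervalIntegrable_finsetSum fun j _ => hcov i j).const_mul _),
      intervalIntegral.integral_sub h1 h2, intervalIntegral.integral_const_mul,
      intervalIntegral.integral_finsetSum fun i _ =>
        intervalIntegrable_finsetSum fun j _ => hcov i j]
    simp only [intervalIntegral.integral_finsetSum fun j _ => hcov _ j]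
  rw [portfolioValue, expShift, follmerIntegral, (h.tendsto_follmerSum_quotPath hS ht htT).limUnder_eq,
    h.integral_bondIntegrand hr hS hSpos hT ht']
  simp only [(h.hasRSIntegral_covIntegrand hS ht' _ _).rsIntegral_eq ht]
  rw [extParam, Fin.tail_cons, Fin.cons_zero, hC]
  congr 1
  ring

theorem stockHoldings_eq (h : PortfolioRep P r S π T U V g A α ν q ρ)
    (hr : ∀ T : ℝ, 0 < T → IntegrableOn r (Icc 0 T) volume)
    (hS : IsQV P S) (hSpos : ∀ t, 0 ≤ t → ∀ i, 0 < S t i) (ht : 0 ≤ t) (htT : t < T) (k : Fin d) :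
    stockHoldings P r S π t k =
      partialX (expShift g) k (S t, extParam S π g A α ν q ρ t) := by
  have ht' : t ∈ Icc 0 T := ⟨ht, htT.le⟩
  rw [((h.isC21.expShift h.isOpen_left h.isOpen_right).2 _
    ⟨h.mem_left t ht', h.extParam_mem ht'⟩ k).1, ← h.portfolioValue_eq hr hS hSpos ht htT]
  change _ = partialX g k (S t, A t) * _
  rw [← h.quot_eq t ht' k, stockHoldings]
  ring

/-- In Itô's formula for `V^π` all terms but the return on the cash position cancel. -/
theorem itoDrift_expShift (h : PortfolioRep P r S π T U V g A α ν q ρ)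
    (hr : ∀ T : ℝ, 0 < T → IntegrableOn r (Icc 0 T) volume)
    (hS : IsQV P S) (hSpos : ∀ t, 0 ≤ t → ∀ i, 0 < S t i) (ht : 0 ≤ t) (htT : t < T) :
    itoDrift (expShift g) S q (extParam S π g A α ν q ρ) (extDensity S π g A α q ρ) t =
      (1 - ∑ i, π t i) * portfolioValue P r S π t * ρ t := by
  have ht' : t ∈ Icc 0 T := ⟨ht, htT.le⟩
  have hmem : (S t, extParam S π g A α ν q ρ t) ∈
      U ×ˢ (Fin.tail ⁻¹' V : Set (Fin (n + 1) → ℝ)) := ⟨h.mem_left t ht', h.extParam_mem ht'⟩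
  have h2 : ∀ i j, partialX (partialX (expShift g) i) j (S t, extParam S π g A α ν q ρ t) *
      q i j t = portfolioValue P r S π t *
        (partialX (partialX g i) j (S t, A t) * q i j t + covIntegrand S π i j t * q i j t) := by
    intro i j
    rw [((h.isC21.expShift h.isOpen_left h.isOpen_right).2 _ hmem i).2 j,
      ← h.portfolioValue_eq hr hS hSpos ht htT, covIntegrand, ← div_mul_div_comm,
      h.quot_eq t ht' i, h.quot_eq t ht' j]
    change (partialX (partialX g i) j (S t, A t) +
      partialX g i (S t, A t) * partialX g j (S t, A t)) * _ * _ = _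
    ring
  rw [itoDrift, h.isC21.fderiv_expShift h.isOpen_left h.isOpen_right hmem,
    ← h.portfolioValue_eq hr hS hSpos ht htT]
  simp only [h2, ← Finset.mul_sum, Finset.sum_add_distrib]
  change _ * (fderiv ℝ g (S t, A t) (0, α t) + logDrift S π g A α q ρ t) + _ = _
  rw [logDrift, itoDrift]
  ring

theorem tendsto_follmerSum_stockHoldings (h : PortfolioRep P r S π T U V g A α ν q ρ)
    (hr : ∀ T : ℝ, 0 < T → IntegrableOn r (Icc 0 T) volume)
    (hS : IsQV P S) (hSpos : ∀ t, 0 ≤ t → ∀ i, 0 < S t i) (ht : 0 ≤ t) (htT : t < T) :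
    Tendsto (follmerSum P (stockHoldings P r S π) S t) atTop
      (𝓝 (portfolioValue P r S π t - portfolioValue P r S π 0 -
        ∫ s in (0 : ℝ)..t, (1 - ∑ i, π s i) * portfolioValue P r S π s * ρ s ∂ν)) := by
  have := h.noAtoms
  have hT : 0 < T := ht.trans_lt htT
  rw [follmerSum_congr P (ξ' := fun s i => partialX (expShift g) i
    (S s, extParam S π g A α ν q ρ s)) fun s hs => funext fun k =>
    h.stockHoldings_eq hr hS hSpos hs.1 (hs.2.trans_lt htT) k]
  have h1 := tendsto_follmerSum_partialX hS h.density_cov (h.hasDensity_extParam hS hSpos hT.le)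
    h.isOpen_left (h.isOpen_right.preimage continuous_tail)
    (h.isC21.expShift h.isOpen_left h.isOpen_right).1 h.mem_left (fun s hs => h.extParam_mem hs)
    ht htT
  rw [← h.portfolioValue_eq hr hS hSpos ht htT, ← h.portfolioValue_eq hr hS hSpos le_rfl hT] at h1
  convert! h1 using 3
  refine intervalIntegral.integral_congr fun s hs => ?_
  rw [uIcc_of_le ht] at hs
  exact (h.itoDrift_expShift hr hS hSpos hs.1 (hs.2.trans_lt htT)).symm

theorem continuousOn_portfolioValue (h : PortfolioRep P r S π T U V g A α ν q ρ)
    (hr : ∀ T : ℝ, 0 < T → IntegrableOn r (Icc 0 T) volume)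
    (hS : IsQV P S) (hSpos : ∀ t, 0 ≤ t → ∀ i, 0 < S t i) (ht : 0 ≤ t) (htT : t < T) :
    ContinuousOn (portfolioValue P r S π) (Icc 0 t) := by
  have := h.noAtoms
  have hT : 0 < T := ht.trans_lt htT
  have hE : ContinuousOn (extParam S π g A α ν q ρ) (Icc 0 T) :=
    continuousOn_pi.2 fun j => (h.hasDensity_extParam hS hSpos hT.le j).continuousOn
  have h1 := (h.isC21.expShift h.isOpen_left h.isOpen_right).1.contDiffOn.continuousOn.comp
    ((hS.continuousOn.mono Icc_subset_Ici_self).prodMk hE)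
    fun s hs => ⟨h.mem_left s hs, h.extParam_mem hs⟩
  exact (h1.mono (Icc_subset_Icc_right htT.le)).congr fun s hs =>
    h.portfolioValue_eq hr hS hSpos hs.1 (hs.2.trans_lt htT)

theorem hasDensity_bond (h : PortfolioRep P r S π T U V g A α ν q ρ)
    (ht : 0 ≤ t) (htT : t < T) : HasDensity ν t (bond r) (fun s => bond r s * ρ s) :=
  have := h.noAtoms
  h.density_rate.exp P ht htT

theorem continuousOn_bondHoldings (h : PortfolioRep P r S π T U V g A α ν q ρ)
    (hr : ∀ T : ℝ, 0 < T → IntegrableOn r (Icc 0 T) volume)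
    (hS : IsQV P S) (hSpos : ∀ t, 0 ≤ t → ∀ i, 0 < S t i) (ht : 0 ≤ t) (htT : t < T) :
    ContinuousOn (bondHoldings P r S π) (Icc 0 t) := by
  have := h.noAtoms
  exact (((h.continuousOn_cash hS hSpos).mono (Icc_subset_Icc_right htT.le)).mul
    (h.continuousOn_portfolioValue hr hS hSpos ht htT)).div
    (h.hasDensity_bond ht htT).continuousOn fun s _ => (Real.exp_pos _).ne'

theorem hasRSIntegral_bondHoldings (h : PortfolioRep P r S π T U V g A α ν q ρ)
    (hr : ∀ T : ℝ, 0 < T → IntegrableOn r (Icc 0 T) volume)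
    (hS : IsQV P S) (hSpos : ∀ t, 0 ≤ t → ∀ i, 0 < S t i) (ht : 0 ≤ t) (htT : t < T) :
    HasRSIntegral (bondHoldings P r S π) (bond r) 0 t
      (∫ s in (0 : ℝ)..t, (1 - ∑ i, π s i) * portfolioValue P r S π s * ρ s ∂ν) := by
  convert! (h.hasDensity_bond ht htT).hasRSIntegral ht
    (h.continuousOn_bondHoldings hr hS hSpos ht htT) using 3
  rename_i s
  have hB : bond r s ≠ 0 := (Real.exp_pos _).ne'
  rw [bondHoldings]
  field_simp

end PortfolioRep

/-! ### The self-financing strategy -/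

theorem continuousOn_Ici_of_forall_Icc {f : ℝ → ℝ}
    (h : ∀ T : ℝ, 0 < T → ContinuousOn f (Icc 0 T)) : ContinuousOn f (Ici 0) := by
  intro x hx
  have hx' : x < x + 1 := lt_add_one x
  refine (h (x + 1) (lt_of_le_of_lt hx hx') x ⟨hx, hx'.le⟩).mono_of_mem_nhdsWithin ?_
  rw [← Ici_inter_Iic]
  exact inter_mem_nhdsWithin _ (Iic_mem_nhds hx')

theorem locallyBoundedVariationOn_bond (P : PartitionSeq) {r : ℝ → ℝ}
    (hr : ∀ T : ℝ, 0 < T → IntegrableOn r (Icc 0 T) volume) :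
    LocallyBoundedVariationOn (bond r) (Ici 0) := by
  intro a b ha hb
  have h := ((hasDensity_rate hr (T := b + 1) (add_pos_of_nonneg_of_pos hb one_pos)).exp P hb
    (lt_add_one b)).boundedVariationOn
  exact h.mono fun x hx => ⟨hx.1, hx.2.2⟩

section

variable {d : ℕ} {P : PartitionSeq} {r : ℝ → ℝ} {S π : ℝ → Fin d → ℝ}

theorem isAdmissible_stockHoldings
    (hr : ∀ T : ℝ, 0 < T → IntegrableOn r (Icc 0 T) volume) (hS : IsQV P S)
    (hSpos : ∀ t, 0 ≤ t → ∀ i, 0 < S t i) (hπ : IsAdmissible (logPath S) π) :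
    IsAdmissible S (stockHoldings P r S π) := by
  intro T hT
  have hT' : T < T + 1 := lt_add_one T
  have hT0 : 0 < T + 1 := hT.trans hT'
  obtain ⟨n, U, V, g, A, α, ν, q, ρ, h⟩ := exists_portfolioRep hr hS hSpos hπ hT0
  have := h.noAtoms
  have hsub : Icc 0 T ⊆ Icc 0 (T + 1) := Icc_subset_Icc_right hT'.le
  have hd := h.hasDensity_extParam hS hSpos hT0.le
  refine ⟨n + 1, U, Fin.tail ⁻¹' V, expShift g, PortfolioRep.extParam S π g A α ν q ρ,
    h.isOpen_left, h.isOpen_right.preimage continuous_tail,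
    (h.isC21.expShift h.isOpen_left h.isOpen_right).1,
    ⟨fun t ht => h.extParam_mem (hsub ht),
      continuousOn_pi.2 fun j => (hd j).continuousOn.mono hsub,
      fun j => (hd j).boundedVariationOn.mono hsub⟩, fun t ht => ⟨h.mem_left t (hsub ht),
      fun k => h.stockHoldings_eq hr hS hSpos ht.1 (ht.2.trans_lt hT') k⟩⟩

theorem continuousOn_bondHoldings
    (hr : ∀ T : ℝ, 0 < T → IntegrableOn r (Icc 0 T) volume) (hS : IsQV P S)
    (hSpos : ∀ t, 0 ≤ t → ∀ i, 0 < S t i) (hπ : IsAdmissible (logPath S) π) :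
    ContinuousOn (bondHoldings P r S π) (Ici 0) := by
  refine continuousOn_Ici_of_forall_Icc fun T hT => ?_
  have hT' : T < T + 1 := lt_add_one T
  obtain ⟨n, U, V, g, A, α, ν, q, ρ, h⟩ := exists_portfolioRep hr hS hSpos hπ (hT.trans hT')
  exact h.continuousOn_bondHoldings hr hS hSpos hT.le hT'

theorem wealth_holdings (hSpos : ∀ t, 0 ≤ t → ∀ i, 0 < S t i) {t : ℝ} (ht : 0 ≤ t) :
    wealth S (bond r) (stockHoldings P r S π) (bondHoldings P r S π) t =
      portfolioValue P r S π t := by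
  have h1 : ∀ i, stockHoldings P r S π t i * S t i = π t i * portfolioValue P r S π t := fun i =>
    div_mul_cancel₀ _ (hSpos t ht i).ne'
  have h2 : bondHoldings P r S π t * bond r t = (1 - ∑ i, π t i) * portfolioValue P r S π t :=
    div_mul_cancel₀ _ (Real.exp_pos _).ne'
  rw [wealth, dotProduct, Finset.sum_congr rfl fun i _ => h1 i, h2, ← Finset.sum_mul]
  ring

theorem isTradingStrategy_holdings
    (hr : ∀ T : ℝ, 0 < T → IntegrableOn r (Icc 0 T) volume) (hS : IsQV P S)
    (hSpos : ∀ t, 0 ≤ t → ∀ i, 0 < S t i) (hπ : IsAdmissible (logPath S) π) :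
    IsTradingStrategy S (bond r) (stockHoldings P r S π) (bondHoldings P r S π) where
  admissible := isAdmissible_stockHoldings hr hS hSpos hπ
  measurable := (continuousOn_iff_continuous_domRestrict.1
    (continuousOn_bondHoldings hr hS hSpos hπ)).measurable
  integrable := by
    refine ⟨locallyBoundedVariationOn_bond P hr, fun T _ => ?_⟩
    -- `η` is bounded on `[0, T]`, and `d|B|` is finite there.
    obtain ⟨C, hC⟩ := isCompact_Icc.exists_bound_of_continuousOn
      ((continuousOn_bondHoldings hr hS hSpos hπ).mono (Icc_subset_Ici_self : Icc 0 T ⊆ Ici 0))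
    calc ∫⁻ s in Icc 0 T, ‖bondHoldings P r S π s‖ₑ
          ∂(variationMeasure (bond r) (locallyBoundedVariationOn_bond P hr))
        ≤ ∫⁻ _ in Icc 0 T, ENNReal.ofReal C
          ∂(variationMeasure (bond r) (locallyBoundedVariationOn_bond P hr)) := by
          refine setLIntegral_mono measurable_const fun s hs => ?_
          rw [← ofReal_norm]
          exact ENNReal.ofReal_le_ofReal (hC s hs)
      _ < ⊤ := by
          rw [setLIntegral_const]
          refine ENNReal.mul_lt_top ENNReal.ofReal_lt_top ?_
          rw [variationMeasure, StieltjesFunction.measure_Icc]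
          exact ENNReal.ofReal_lt_top

end

end Follmer

end

theorem lemma2p5 {d : ℕ} (P : Follmer.PartitionSeq) (r : ℝ → ℝ)
    (hr : ∀ T : ℝ, 0 < T → IntegrableOn r (Icc 0 T) volume)
    (S : ℝ → Fin d → ℝ) (hS : Follmer.IsQV P S) (hSpos : ∀ t, 0 ≤ t → ∀ i, 0 < S t i)
    (π : ℝ → Fin d → ℝ) (hπ : Follmer.IsAdmissible (Follmer.logPath S) π) :
    (Follmer.IsAdmissible S (Follmer.quotPath π S) ∧
      ∀ t, 0 ≤ t →
        Follmer.FollmerIntegrable P (Follmer.quotPath π S) S t ∧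
        (∀ i j, Follmer.RSIntegrable (Follmer.covIntegrand S π i j)
          (Follmer.covariation P (fun s => S s i) (fun s => S s j)) 0 t) ∧
        IntervalIntegrable (Follmer.bondIntegrand r π) volume 0 t) ∧
    Follmer.IsSelfFinancing P S (Follmer.bond r)
      (Follmer.stockHoldings P r S π) (Follmer.bondHoldings P r S π) ∧
    ∀ t, 0 ≤ t →
      Follmer.wealth S (Follmer.bond r)
        (Follmer.stockHoldings P r S π) (Follmer.bondHoldings P r S π) t =
      Follmer.portfolioValue P r S π t := by
  -- The sums up to time `t` involve a partition point beyond `t`, so a horizon larger than `t` is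
  -- needed.
  have hrep : ∀ t : ℝ, 0 ≤ t → _ := fun t ht => Follmer.exists_portfolioRep hr hS hSpos hπ
    (add_pos_of_nonneg_of_pos ht one_pos)
  refine ⟨⟨fun T hT => Follmer.exists_quotPath_rep hSpos hπ hT, fun t ht => ?_⟩,
    ⟨Follmer.isTradingStrategy_holdings hr hS hSpos hπ, fun t ht => ?_, fun t ht => ?_,
      fun t ht => ?_⟩, fun t ht => Follmer.wealth_holdings hSpos ht⟩ <;>
    obtain ⟨n, U, V, g, A, α, ν, q, ρ, h⟩ := hrep t ht
  · have ht' : t ∈ Icc 0 (t + 1) := ⟨ht, (lt_add_one t).le⟩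
    refine ⟨⟨_, h.tendsto_follmerSum_quotPath hS ht (lt_add_one t)⟩,
      fun i j => ⟨_, h.hasRSIntegral_covIntegrand hS ht' i j⟩, ?_⟩
    have hT : 0 < t + 1 := ht.trans_lt (lt_add_one t)
    refine (h.intervalIntegrable_bondIntegrand hr hS hSpos hT).mono_set
      (uIcc_subset_uIcc left_mem_uIcc ?_)
    rwa [uIcc_of_le hT.le]
  · exact ⟨_, h.tendsto_follmerSum_stockHoldings hr hS hSpos ht (lt_add_one t)⟩
  · exact ⟨_, h.hasRSIntegral_bondHoldings hr hS hSpos ht (lt_add_one t)⟩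
  · rw [Follmer.wealth_holdings hSpos ht, Follmer.wealth_holdings hSpos le_rfl,
      Follmer.follmerIntegral,
      (h.tendsto_follmerSum_stockHoldings hr hS hSpos ht (lt_add_one t)).limUnder_eq,
      (h.hasRSIntegral_bondHoldings hr hS hSpos ht (lt_add_one t)).rsIntegral_eq ht]
    ring
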